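/- **Theorem (Strong functional representation lemma).** All logarithms are to base $2$, and entropies and mutual informations are in bits. Let $X$ and $Y$ be random variables on a common probability space, with values in Polish spaces $\mathcal X$ and $\mathcal Y$ with their Borel $\sigma$-algebras, such that the mutual information $I(X;Y)=D(P_{XY}\,\|\,P_X\times P_Y)$ is finite. Then, after enlarging the probability space if necessary (without changing the joint law of $(X,Y)$), there exist a random variable $Z$ with values in a Polish space $\mathcal Z$, independent of $X$, and a measurable function $g:\mathcal X\times\mathcal Z\to\mathcal Y$ such that $Y=g(X,Z)$ almost surely and $$I(X;Z\mid Y)\le \log\bigl(I(X;Y)+1\bigr)+4 ,$$ and also (equivalently, since $I(X;Z|Y)=H(Y|Z)-I(X;Y)$ for such $Z$) $$H(Y\mid Z)\le I(X;Y)+\log\bigl(I(X;Y)+1\bigr)+4 .$$ Here $I(X;Z|Y)=D\bigl(P_{YXZ}\,\|\,P_Y\otimes(P_{X|Y}\times P_{Z|Y})\bigr)$ and $H(Y|Z)=\int H(P_{Y|Z=z})\,dP_Z(z)$, where the entropy $H(\nu)$ of a probability measure $\nu$ is $\sum_y \nu\{y\}\log\frac1{\nu\{y\}}$ if $\nu$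 is discrete and $\infty$ otherwise. Moreover, if $X$ and $Y$ almost surely take values in finite sets $A\subseteq\mathcal X$ and $B\subseteq\mathcal Y$, respectively, then a $Z$ with all the above properties can be chosen with values in a set $\mathcal Z$ of cardinality $$|\mathcal Z|\le |A|\,(|B|-1)+2 .$$ -/

import Mathlib

open MeasureTheory ProbabilityTheory InformationTheory
open scoped ENNReal

universe u v w

noncomputable section

/-- Mutual information `I(X;Y) = D(P_{XY} ‖ P_X × P_Y)`, in bits. -/
def mutualInfo {Ω : Type*} {𝒳 : Type*} {𝒴 : Type*} [MeasurableSpace Ω] [MeasurableSpace 𝒳]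
    [MeasurableSpace 𝒴] (X : Ω → 𝒳) (Y : Ω → 𝒴) (P : Measure Ω) : ℝ≥0∞ :=
  klDiv (P.map fun ω => (X ω, Y ω)) ((P.map X).prod (P.map Y)) / ENNReal.ofReal (Real.log 2)

/-- Conditional mutual information `I(X;Z|Y) = D(P_{YXZ} ‖ P_Y ⊗ (P_{X|Y} × P_{Z|Y}))`, in bits,
where `P_{X|Y}` and `P_{Z|Y}` are regular conditional distributions. -/
def condMutualInfo {Ω : Type*} {𝒳 : Type*} {𝒵 : Type*} {𝒴 : Type*} [MeasurableSpace Ω]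
    [MeasurableSpace 𝒳] [StandardBorelSpace 𝒳] [Nonempty 𝒳]
    [MeasurableSpace 𝒵] [StandardBorelSpace 𝒵] [Nonempty 𝒵] [MeasurableSpace 𝒴]
    (X : Ω → 𝒳) (Z : Ω → 𝒵) (Y : Ω → 𝒴) (P : Measure Ω) [IsFiniteMeasure P] : ℝ≥0∞ :=
  klDiv (P.map fun ω => (Y ω, X ω, Z ω))
    ((P.map Y) ⊗ₘ (condDistrib X Y P ×ₖ condDistrib Z Y P)) / ENNReal.ofReal (Real.log 2)

/-- Shannon entropy of a probability measure, in bits: the mean of `log₂ (1 / ν {y})`. It is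
`∑ y, ν {y} * log₂ (1 / ν {y})` if `ν` is discrete, and `∞` if `ν` is not discrete. -/
def shannonEntropy {𝒴 : Type*} [MeasurableSpace 𝒴] (ν : Measure 𝒴) : ℝ≥0∞ :=
  open Classical in
  ∫⁻ y, (if ν {y} = 0 then ∞ else ENNReal.ofReal (-Real.logb 2 (ν {y}).toReal)) ∂ν

/-- Conditional entropy `H(Y|Z) = ∫ H(P_{Y|Z=z}) dP_Z(z)`, in bits. -/
def condEntropy {Ω : Type*} {𝒴 : Type*} {𝒵 : Type*} [MeasurableSpace Ω]
    [MeasurableSpace 𝒴] [StandardBorelSpace 𝒴] [Nonempty 𝒴] [MeasurableSpace 𝒵]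
    (Y : Ω → 𝒴) (Z : Ω → 𝒵) (P : Measure Ω) [IsFiniteMeasure P] : ℝ≥0∞ :=
  ∫⁻ z, shannonEntropy (condDistrib Y Z P z) ∂(P.map Z)

end

/-!
The representation is obtained by greedy rejection sampling. Let `f (x, ·)` be the density of the
conditional law of `Y` given `X = x` with respect to the law `ρ` of `Y`. The variable `Z` is an
i.i.d. sequence of proposals `(y, u)`, with `y` of law `ρ` and `u` an independent uniform variable.
Put `G l = ∫ (f (x, y) - l)⁺ dρ`, `L 0 = 0` and `L (n + 1) = L n + G (L n)`. Round `n` is reached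
with probability `G (L n)`, and its proposal is accepted if the level `L n + u G (L n)` is below
`f (x, y)`. Thus the rounds hand out the mass of the density slice by slice, the accepted point
`g (x, Z)` has the required law (`infinitePi_accepted`), and its level `t` is uniform below
`f (x, y)`.

Let `K` be the number of rounds. Since `n G (L n) ≤ L n` and `1 - l ≤ G l`, one has
`K ≤ t / (G t (1 - G t))`. Here `E log t = D - 1` in nats, where `D` is the divergence of the
conditional law from `ρ`, and `G t` is uniform on `[0, 1]`. Hence `E log K ≤ D + 1`
(`tsum_log_mul_le`); on average over `x` this is `I(X;Y) + log₂ e` in bits.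

Given `Z`, the point `Y` is a function of `K`, so by Gibbs' inequality (`shannonEntropy_map_le`)
`H(Y|Z)` is at most the mean of `-log q(K)` for any weights `q`. The power weights `powerWeight`
give the bound on `H(Y|Z)`, with the numerical constant estimated in `log_bound_le`. The bound on
`I(X;Z|Y)` follows from `I(X;Z|Y) + I(X;Y) = I(X;(Y,Z)) ≤ H(Y|Z)`, by the chain rule for the
divergence (`condMutualInfo_add_mutualInfo_le`).

If `X` and `Y` take finitely many values, only the random function `g (·, Z) : A → B` matters.
Its law can be replaced by one of small support with the same law of `(X, Y)` and no larger
`H(Y|Z)`, by Carathéodory's theorem (`exists_finite_support`).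
-/

noncomputable section

/-! ### Divergence from a density -/

section Divergence

variable {α : Type*} [MeasurableSpace α]

theorem klDiv_withDensity_eq (ν : Measure α) [IsProbabilityMeasure ν] (φ : α → ℝ≥0∞)
    (hφ : Measurable φ) [IsProbabilityMeasure (ν.withDensity φ)]
    (h1 : ∀ᵐ a ∂(ν.withDensity φ), 1 ≤ φ a) :
    klDiv (ν.withDensity φ) ν
      = ∫⁻ a, ENNReal.ofReal (Real.log (φ a).toReal) ∂(ν.withDensity φ) := by
  set μ := ν.withDensity φ with hμ
  have hac : μ ≪ ν := withDensity_absolutelyContinuous ν φ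
  have hllr : llr μ ν =ᵐ[μ] fun a => Real.log (φ a).toReal := by
    filter_upwards [hac.ae_le (Measure.rnDeriv_withDensity ν hφ)] with a ha
    rw [llr, ha]
  have hfin : ∀ᵐ a ∂μ, φ a ≠ ∞ := by
    have h := hac.ae_le (Measure.rnDeriv_lt_top μ ν)
    filter_upwards [h, hac.ae_le (Measure.rnDeriv_withDensity ν hφ)] with a ha h'a
    rw [← h'a]; exact ha.ne
  have hnn : 0 ≤ᵐ[μ] fun a => Real.log (φ a).toReal := by
    filter_upwards [h1, hfin] with a ha ha'
    refine Real.log_nonneg ?_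
    rw [← ENNReal.toReal_one]
    exact (ENNReal.toReal_le_toReal ENNReal.one_ne_top ha').2 ha
  have hmeas : Measurable fun a => Real.log (φ a).toReal :=
    Real.measurable_log.comp hφ.ennreal_toReal
  by_cases hint : Integrable (fun a => Real.log (φ a).toReal) μ
  · rw [klDiv_of_ac_of_integrable hac ((integrable_congr hllr).2 hint)]
    simp only [probReal_univ, add_sub_cancel_right]
    rw [integral_congr_ae hllr, ofReal_integral_eq_lintegral_ofReal hint hnn]
  · rw [klDiv_of_not_integrable (fun h => hint ((integrable_congr hllr).1 h))]
    by_contra hne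
    exact hint ((lintegral_ofReal_ne_top_iff_integrable hmeas.aestronglyMeasurable hnn).1
      (Ne.symm hne))

end Divergence

/-! ### Functions of independent variables -/

section FiberKernel

variable {𝒳 : Type*} {𝒴 : Type*} {𝒵 : Type*} [MeasurableSpace 𝒳] [MeasurableSpace 𝒴]
  [MeasurableSpace 𝒵]

/-- The kernel sending `z` to the law of `g (·, z)` under `ρ`: the conditional law of `g (X, Z)`
given `Z = z` when `X` has law `ρ` and is independent of `Z`. -/
def fiberKernel (ρ : Measure 𝒳) (g : 𝒳 × 𝒵 → 𝒴) : Kernel 𝒵 𝒴 :=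
  (Kernel.const 𝒵 ρ ×ₖ Kernel.id).map g

theorem isMarkovKernel_fiberKernel (ρ : Measure 𝒳) [IsProbabilityMeasure ρ] {g : 𝒳 × 𝒵 → 𝒴}
    (hg : Measurable g) : IsMarkovKernel (fiberKernel ρ g) :=
  Kernel.IsMarkovKernel.map _ hg

theorem fiberKernel_apply (ρ : Measure 𝒳) [IsProbabilityMeasure ρ] {g : 𝒳 × 𝒵 → 𝒴}
    (hg : Measurable g) (z : 𝒵) : fiberKernel ρ g z = ρ.map fun x => g (x, z) := by
  rw [fiberKernel, Kernel.map_apply _ hg, Kernel.prod_apply, Kernel.const_apply, Kernel.id_apply,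
    Measure.prod_dirac, Measure.map_map hg (by fun_prop)]
  rfl

theorem compProd_fiberKernel (ρ : Measure 𝒳) [IsProbabilityMeasure ρ] (μ : Measure 𝒵)
    [IsProbabilityMeasure μ] {g : 𝒳 × 𝒵 → 𝒴} (hg : Measurable g) :
    μ ⊗ₘ fiberKernel ρ g = (ρ.prod μ).map fun p => (p.2, g p) := by
  have := isMarkovKernel_fiberKernel ρ hg
  ext s hs
  rw [Measure.compProd_apply hs, Measure.map_apply (by fun_prop) hs,
    Measure.prod_apply_symm ((by fun_prop : Measurable fun p : 𝒳 × 𝒵 => (p.2, g p)) hs)]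
  refine lintegral_congr fun z => ?_
  rw [fiberKernel_apply ρ hg, Measure.map_apply (by fun_prop) (measurable_prodMk_left hs)]
  rfl

theorem Kernel.measurable_singleton_apply [MeasurableEq 𝒴] (κ : Kernel 𝒵 𝒴)
    [IsSFiniteKernel κ] : Measurable fun p : 𝒵 × 𝒴 => κ p.1 {p.2} := by
  have ht : MeasurableSet {q : (𝒵 × 𝒴) × 𝒴 | q.2 = q.1.2} :=
    measurableSet_eq_fun (by fun_prop) (by fun_prop)
  exact Kernel.measurable_kernel_prodMk_left (κ := κ.comap Prod.fst measurable_fst) ht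

/-- If `X` and `Z` are independent with laws `ρ` and `μ`, and `Y = g (X, Z)`, then
`I(X;(Y,Z)) ≤ H(Y|Z)`. Equality holds, but is not needed. -/
theorem klDiv_map_prod_le [StandardBorelSpace 𝒴] (ρ : Measure 𝒳) [IsProbabilityMeasure ρ]
    (μ : Measure 𝒵) [IsProbabilityMeasure μ] {g : 𝒳 × 𝒵 → 𝒴} (hg : Measurable g) :
    klDiv ((ρ.prod μ).map fun p => ((p.2, g p), p.1))
        (((ρ.prod μ).map fun p => (p.2, g p)).prod ρ)
      ≤ (∫⁻ z, shannonEntropy (fiberKernel ρ g z) ∂μ) * ENNReal.ofReal (Real.log 2) := by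
  have := isMarkovKernel_fiberKernel ρ hg
  set η := fiberKernel ρ g with hη
  have hsing : Measurable fun p : 𝒵 × 𝒴 => η p.1 {p.2} := Kernel.measurable_singleton_apply η
  have hlog : 0 < Real.log 2 := Real.log_pos one_lt_two
  have hηg : ∀ {F : 𝒴 → ℝ≥0∞} (hF : Measurable F) (z : 𝒵),
      ∫⁻ y, F y ∂(η z) = ∫⁻ x, F (g (x, z)) ∂ρ := by
    intro F hF z
    rw [hη, fiberKernel_apply ρ hg, lintegral_map hF (by fun_prop)]
  set E : 𝒵 × 𝒴 → ℝ≥0∞ := fun p =>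
    if η p.1 {p.2} = 0 then ∞ else ENNReal.ofReal (-Real.logb 2 (η p.1 {p.2}).toReal) with hE
  have hEm : Measurable E := by
    refine Measurable.ite (hsing (measurableSet_singleton 0)) measurable_const ?_
    refine ENNReal.measurable_ofReal.comp (Measurable.neg ?_)
    exact (Real.measurable_log.comp hsing.ennreal_toReal).div_const _
  have hH : ∫⁻ z, shannonEntropy (η z) ∂μ = ∫⁻ p, E (p.2, g p) ∂(ρ.prod μ) := by
    rw [lintegral_prod_symm _ (by fun_prop)]
    refine lintegral_congr fun z => ?_
    rw [← hηg (F := fun y => E (z, y)) (by fun_prop) z]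
    simp only [shannonEntropy, hE]
  by_cases htop : ∫⁻ z, shannonEntropy (η z) ∂μ = ∞
  · rw [htop, ENNReal.top_mul (by simpa using hlog)]; exact le_top
  rw [hH] at htop ⊢
  have hpos : ∀ᵐ p ∂(ρ.prod μ), η p.2 {g p} ≠ 0 := by
    filter_upwards [ae_lt_top (by fun_prop) htop] with p hp h0
    simp [hE, h0] at hp
  have hW : Measurable fun p : 𝒳 × 𝒵 => ((p.2, g p), p.1) := by fun_prop
  set α := (ρ.prod μ).map fun p => ((p.2, g p), p.1) with hα
  set β := ((ρ.prod μ).map fun p => (p.2, g p)).prod ρ with hβ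
  have hβ' : β = (μ ⊗ₘ η).prod ρ := by rw [hβ, hη, compProd_fiberKernel ρ μ hg]
  have : IsProbabilityMeasure α := Measure.isProbabilityMeasure_map hW.aemeasurable
  have : IsProbabilityMeasure β := by rw [hβ']; infer_instance
  classical
  -- On the graph `y = g (x, z)` the density of the joint law with respect to the law with
  -- independent coordinates is the reciprocal of the conditional mass of `y` given `z`.
  set φ : (𝒵 × 𝒴) × 𝒳 → ℝ≥0∞ := fun q => if q.1.2 = g (q.2, q.1.1) then (η q.1.1 {q.1.2})⁻¹ else 0
    with hφ
  have hφm : Measurable φ := by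
    refine Measurable.ite (measurableSet_eq_fun (by fun_prop) (by fun_prop)) ?_ measurable_const
    exact (hsing.comp measurable_fst).inv
  have hd : β.withDensity φ = α := by
    ext s hs
    rw [withDensity_apply _ hs, ← lintegral_indicator hs, hβ',
      lintegral_prod_symm _ ((hφm.indicator hs).aemeasurable), hα, Measure.map_apply hW hs,
      ← lintegral_indicator_one (hW hs),
      lintegral_prod _ ((measurable_one.indicator (hW hs)).aemeasurable)]
    refine lintegral_congr_ae ?_
    filter_upwards [Measure.ae_ae_of_ae_prod hpos] with x hx
    rw [Measure.lintegral_compProd (f := fun p => s.indicator φ (p, x))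
      ((hφm.indicator hs).comp (by fun_prop))]
    refine lintegral_congr_ae ?_
    filter_upwards [hx] with z hz
    have : ∀ y, s.indicator φ ((z, y), x) =
        ({g (x, z)} : Set 𝒴).indicator
          (fun y => s.indicator (fun _ => (η z {y})⁻¹) ((z, y), x)) y := by
      intro y
      by_cases hy : y = g (x, z)
      · by_cases hys : ((z, y), x) ∈ s <;> simp_all
      · by_cases hys : ((z, y), x) ∈ s <;> simp_all
    simp_rw [this]
    rw [lintegral_indicator (measurableSet_singleton _), lintegral_singleton]
    by_cases hys : ((z, g (x, z)), x) ∈ s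
    · rw [Set.indicator_of_mem hys, Set.indicator_of_mem (by simpa using hys),
        ENNReal.inv_mul_cancel hz (measure_ne_top _ _)]
      rfl
    · rw [Set.indicator_of_notMem hys, Set.indicator_of_notMem (by simpa using hys), zero_mul]
  have : IsProbabilityMeasure (β.withDensity φ) := by rw [hd]; infer_instance
  have h1 : ∀ᵐ a ∂(β.withDensity φ), 1 ≤ φ a := by
    rw [hd, hα, ae_map_iff hW.aemeasurable (measurableSet_le measurable_const hφm)]
    refine Filter.Eventually.of_forall fun p => ?_
    simpa [hφ] using prob_le_one
  rw [← hd, klDiv_withDensity_eq β φ hφm h1, hd, hα, lintegral_map _ hW]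
  · rw [← lintegral_mul_const _ (by fun_prop)]
    refine lintegral_mono_ae ?_
    filter_upwards [hpos] with p hp
    simp only [hφ, hE, hp, if_false]
    rw [← ENNReal.ofReal_mul' hlog.le]
    refine ENNReal.ofReal_le_ofReal (le_of_eq ?_)
    simp [Real.logb, ENNReal.toReal_inv, Real.log_inv, hlog.ne']
  · exact ENNReal.measurable_ofReal.comp (Real.measurable_log.comp hφm.ennreal_toReal)

end FiberKernel

/-! ### Enlarging the probability space -/

section Enlargement

variable {Ω : Type*} {𝒳 : Type*} {𝒴 : Type*} {𝒵 : Type*} [MeasurableSpace Ω] [MeasurableSpace 𝒳]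
  [MeasurableSpace 𝒴] [MeasurableSpace 𝒵]

/-- If `(X, g (X, Z))` has the law of `(X, Y)` for some `Z` of law `μ` independent of `X`, then `Z`
can be added to the given probability space: it is drawn from its conditional law given
`(X, g (X, Z))`, evaluated at `(X, Y)`. -/
theorem exists_enlargement [StandardBorelSpace 𝒵] [Nonempty 𝒵] (P : Measure Ω)
    [IsProbabilityMeasure P] {X : Ω → 𝒳} {Y : Ω → 𝒴} (hX : Measurable X) (hY : Measurable Y)
    (μ : Measure 𝒵) [IsProbabilityMeasure μ] {g : 𝒳 × 𝒵 → 𝒴} (hg : Measurable g)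
    (hlaw : ((P.map X).prod μ).map (fun p => (p.1, g p)) = P.map fun ω => (X ω, Y ω)) :
    ∃ Q : Measure (Ω × 𝒵), IsProbabilityMeasure Q ∧ Q.map Prod.fst = P ∧
      Q.map (fun p => ((X p.1, Y p.1), p.2))
        = ((P.map X).prod μ).map fun p => ((p.1, g p), p.2) := by
  have : IsProbabilityMeasure (P.map X) := Measure.isProbabilityMeasure_map hX.aemeasurable
  set N := ((P.map X).prod μ).map fun p => ((p.1, g p), p.2) with hN
  have : IsProbabilityMeasure N := Measure.isProbabilityMeasure_map (by fun_prop)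
  have hfst : N.fst = P.map fun ω => (X ω, Y ω) := by
    rw [← hlaw, hN, Measure.fst, Measure.map_map (by fun_prop) (by fun_prop)]; rfl
  have hXY : Measurable fun ω => (X ω, Y ω) := by fun_prop
  refine ⟨P ⊗ₘ N.condKernel.comap (fun ω => (X ω, Y ω)) hXY, inferInstance, ?_, ?_⟩
  · exact Measure.fst_compProd _ _
  · have h : N = N.fst ⊗ₘ N.condKernel := (N.disintegrate N.condKernel).symm
    ext s hs
    have hNs : N s = (N.fst ⊗ₘ N.condKernel) s := congrArg (fun ν => ν s) h
    rw [hNs, Measure.compProd_apply hs, hfst, lintegral_map _ hXY,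
      Measure.map_apply (by fun_prop) hs, Measure.compProd_apply ((by fun_prop :
        Measurable fun p : Ω × 𝒵 => ((X p.1, Y p.1), p.2)) hs)]
    · rfl
    · exact Kernel.measurable_kernel_prodMk_left hs

variable {Q : Measure Ω} {X : Ω → 𝒳} {Y : Ω → 𝒴} {Z : Ω → 𝒵} {ρ : Measure 𝒳} {μ : Measure 𝒵}
  {g : 𝒳 × 𝒵 → 𝒴}

theorem map_comp_of_map_eq {γ : Type*} [MeasurableSpace γ] (hX : Measurable X) (hY : Measurable Y)
    (hZ : Measurable Z) (hg : Measurable g)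
    (hlaw : Q.map (fun ω => ((X ω, Y ω), Z ω)) = (ρ.prod μ).map fun p => ((p.1, g p), p.2))
    {F : (𝒳 × 𝒴) × 𝒵 → γ} (hF : Measurable F) :
    Q.map (fun ω => F ((X ω, Y ω), Z ω)) = (ρ.prod μ).map fun p => F ((p.1, g p), p.2) := by
  have := congrArg (Measure.map F) hlaw
  rwa [Measure.map_map hF (by fun_prop), Measure.map_map hF (by fun_prop)] at this

theorem ae_eq_of_map_eq [StandardBorelSpace 𝒴] (hX : Measurable X) (hY : Measurable Y)
    (hZ : Measurable Z) (hg : Measurable g)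
    (hlaw : Q.map (fun ω => ((X ω, Y ω), Z ω)) = (ρ.prod μ).map fun p => ((p.1, g p), p.2)) :
    ∀ᵐ ω ∂Q, Y ω = g (X ω, Z ω) := by
  have hs : MeasurableSet {q : (𝒳 × 𝒴) × 𝒵 | q.1.2 = g (q.1.1, q.2)} :=
    measurableSet_eq_fun (by fun_prop) (by fun_prop)
  have h : ∀ᵐ q ∂(Q.map fun ω => ((X ω, Y ω), Z ω)), q.1.2 = g (q.1.1, q.2) := by
    rw [hlaw, ae_map_iff (by fun_prop) hs]
    exact Filter.Eventually.of_forall fun p => rfl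
  exact ae_of_ae_map (by fun_prop) h

variable [IsProbabilityMeasure Q] [IsProbabilityMeasure ρ] [IsProbabilityMeasure μ]

theorem indepFun_of_map_eq (hX : Measurable X) (hY : Measurable Y)
    (hZ : Measurable Z) (hg : Measurable g)
    (hlaw : Q.map (fun ω => ((X ω, Y ω), Z ω)) = (ρ.prod μ).map fun p => ((p.1, g p), p.2)) :
    IndepFun X Z Q := by
  rw [indepFun_iff_map_prod_eq_prod_map_map hX.aemeasurable hZ.aemeasurable]
  rw [map_comp_of_map_eq hX hY hZ hg hlaw (F := fun q => (q.1.1, q.2)) (by fun_prop),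
    map_comp_of_map_eq hX hY hZ hg hlaw (F := fun q => q.1.1) (by fun_prop),
    map_comp_of_map_eq hX hY hZ hg hlaw (F := fun q => q.2) (by fun_prop)]
  change Measure.map id _ = (Measure.map Prod.fst _).prod (Measure.map Prod.snd _)
  simp

theorem condEntropy_eq_of_map_eq [StandardBorelSpace 𝒴] [Nonempty 𝒴] (hX : Measurable X)
    (hY : Measurable Y) (hZ : Measurable Z) (hg : Measurable g)
    (hlaw : Q.map (fun ω => ((X ω, Y ω), Z ω)) = (ρ.prod μ).map fun p => ((p.1, g p), p.2)) :
    condEntropy Y Z Q = ∫⁻ z, shannonEntropy (fiberKernel ρ g z) ∂μ := by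
  have := isMarkovKernel_fiberKernel ρ hg
  have hZμ : Q.map Z = μ := by
    rw [map_comp_of_map_eq hX hY hZ hg hlaw (F := fun q => q.2) (by fun_prop)]
    change Measure.map Prod.snd _ = _
    simp
  have h : condDistrib Y Z Q =ᵐ[Q.map Z] fiberKernel ρ g := by
    refine condDistrib_ae_eq_of_measure_eq_compProd Z hY.aemeasurable ?_
    rw [hZμ, compProd_fiberKernel ρ μ hg]
    exact map_comp_of_map_eq hX hY hZ hg hlaw (F := fun q => (q.2, q.1.2)) (by fun_prop)
  rw [condEntropy]
  rw [hZμ] at h ⊢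
  exact lintegral_congr_ae (h.mono fun z hz => by simp only [hz])

/-- `I(X;Z|Y) + I(X;Y) = I(X;(Y,Z)) = I(X;Y|Z) ≤ H(Y|Z)` when `X` and `Z` are independent. -/
theorem condMutualInfo_add_mutualInfo_le [StandardBorelSpace 𝒳] [Nonempty 𝒳]
    [StandardBorelSpace 𝒴] [Nonempty 𝒴] [StandardBorelSpace 𝒵] [Nonempty 𝒵] (hX : Measurable X)
    (hY : Measurable Y) (hZ : Measurable Z) (hg : Measurable g)
    (hlaw : Q.map (fun ω => ((X ω, Y ω), Z ω)) = (ρ.prod μ).map fun p => ((p.1, g p), p.2)) :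
    condMutualInfo X Z Y Q + mutualInfo X Y Q ≤ condEntropy Y Z Q := by
  have hlog : 0 < Real.log 2 := Real.log_pos one_lt_two
  have hc0 : ENNReal.ofReal (Real.log 2) ≠ 0 := by simpa using hlog
  rw [condMutualInfo, mutualInfo, ← ENNReal.add_div]
  refine ENNReal.div_le_of_le_mul ?_
  rw [condEntropy_eq_of_map_eq hX hY hZ hg hlaw]
  refine le_trans ?_ (klDiv_map_prod_le ρ μ hg)
  have : IsProbabilityMeasure (Q.map X) := Measure.isProbabilityMeasure_map hX.aemeasurable
  have : IsProbabilityMeasure (Q.map Y) := Measure.isProbabilityMeasure_map hY.aemeasurable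
  have : IsProbabilityMeasure (Q.map fun ω => (X ω, Y ω)) :=
    Measure.isProbabilityMeasure_map (by fun_prop)
  have : IsProbabilityMeasure (Q.map fun ω => ((Z ω, Y ω), X ω)) :=
    Measure.isProbabilityMeasure_map (by fun_prop)
  have : IsProbabilityMeasure (Q.map fun ω => (Z ω, Y ω)) :=
    Measure.isProbabilityMeasure_map (by fun_prop)
  have hρ : Q.map X = ρ := by
    rw [map_comp_of_map_eq hX hY hZ hg hlaw (F := fun q => q.1.1) (by fun_prop)]
    change Measure.map Prod.fst _ = _
    simp
  set κX := condDistrib X Y Q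
  set κZ := condDistrib Z Y Q
  set J := Q.map fun ω => (X ω, Y ω)
  set κ := condDistrib Z (fun ω => (X ω, Y ω)) Q
  have hκ : J ⊗ₘ κ = Q.map fun ω => ((X ω, Y ω), Z ω) :=
    compProd_map_condDistrib hZ.aemeasurable
  have hchain := klDiv_compProd_eq_add J ((Q.map X).prod (Q.map Y)) κ
    (κZ.comap Prod.snd measurable_snd)
  have h1 : klDiv (Q.map fun ω => (Y ω, X ω, Z ω)) (Q.map Y ⊗ₘ (κX ×ₖ κZ))
      ≤ klDiv (J ⊗ₘ κ) (J ⊗ₘ κZ.comap Prod.snd measurable_snd) := by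
    have hf : Measurable fun q : (𝒳 × 𝒴) × 𝒵 => (q.1.2, q.1.1, q.2) := by fun_prop
    refine le_of_eq_of_le ?_ (klDiv_map_le _ _ hf)
    congr 1
    · rw [hκ, Measure.map_map hf (by fun_prop)]; rfl
    · have hswap : J = (Q.map Y ⊗ₘ κX).map Prod.swap := by
        rw [compProd_map_condDistrib hX.aemeasurable, Measure.map_map measurable_swap (by fun_prop)]
        rfl
      ext s hs
      have hm := Kernel.measurable_kernel_prodMk_left (κ := κZ.comap Prod.snd measurable_snd)
        (hf hs)
      rw [Measure.map_apply hf hs, Measure.compProd_apply hs, Measure.compProd_apply (hf hs),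
        hswap, lintegral_map hm measurable_swap, Measure.lintegral_compProd (f := fun p : 𝒴 × 𝒳 =>
          (κZ.comap Prod.snd measurable_snd) p.swap (Prod.mk p.swap ⁻¹'
            ((fun q : (𝒳 × 𝒴) × 𝒵 => (q.1.2, q.1.1, q.2)) ⁻¹' s))) (hm.comp measurable_swap)]
      refine lintegral_congr fun y => ?_
      rw [Kernel.prod_apply, Measure.prod_apply (measurable_prodMk_left hs)]
      rfl
  have h2 : klDiv (J ⊗ₘ κ) (((Q.map X).prod (Q.map Y)) ⊗ₘ κZ.comap Prod.snd measurable_snd)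
      ≤ klDiv ((ρ.prod μ).map fun p => ((p.2, g p), p.1))
        (((ρ.prod μ).map fun p => (p.2, g p)).prod ρ) := by
    rw [← map_comp_of_map_eq hX hY hZ hg hlaw (F := fun q => ((q.2, q.1.2), q.1.1)) (by fun_prop),
      ← map_comp_of_map_eq hX hY hZ hg hlaw (F := fun q => (q.2, q.1.2)) (by fun_prop), ← hρ]
    have hf : Measurable fun q : (𝒵 × 𝒴) × 𝒳 => ((q.2, q.1.2), q.1.1) := by fun_prop
    refine le_of_eq_of_le ?_ (klDiv_map_le _ _ hf)
    congr 1
    · rw [hκ, Measure.map_map hf (by fun_prop)]; rfl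
    · have hswap : (Q.map fun ω => (Z ω, Y ω)) = (Q.map Y ⊗ₘ κZ).map Prod.swap := by
        rw [compProd_map_condDistrib hZ.aemeasurable, Measure.map_map measurable_swap (by fun_prop)]
        rfl
      ext s hs
      rw [Measure.map_apply hf hs, Measure.compProd_apply hs, Measure.prod_apply_symm (hf hs),
        lintegral_prod _ (Kernel.measurable_kernel_prodMk_left hs).aemeasurable]
      refine lintegral_congr fun x => ?_
      have hx : MeasurableSet ((fun p : 𝒵 × 𝒴 => (p, x)) ⁻¹'
          ((fun q : (𝒵 × 𝒴) × 𝒳 => ((q.2, q.1.2), q.1.1)) ⁻¹' s)) := measurable_prodMk_right (hf hs)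
      rw [hswap, Measure.map_apply measurable_swap hx, Measure.compProd_apply (measurable_swap hx)]
      rfl
  calc _ ≤ klDiv (J ⊗ₘ κ) (J ⊗ₘ κZ.comap Prod.snd measurable_snd)
        + klDiv J ((Q.map X).prod (Q.map Y)) := by gcongr
    _ = _ := by rw [hchain, add_comm]
    _ ≤ _ := h2

end Enlargement

/-! ### Levels of greedy rejection sampling -/

section Excess

open Filter Topology Set

variable {𝒴 : Type*} [MeasurableSpace 𝒴]

/-- The mass `∫ (r - l)⁺ dρ` of the density `r` lying above the level `l`. -/
def excess (ρ : Measure 𝒴) (r : 𝒴 → ℝ) (l : ℝ) : ℝ :=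
  (∫⁻ y, ENNReal.ofReal (r y - l) ∂ρ).toReal

/-- The levels of greedy rejection sampling: round `n` hands out the mass of the density between
the levels `level n` and `level (n + 1)`. The step is the probability of reaching round `n`. -/
def level (ρ : Measure 𝒴) (r : 𝒴 → ℝ) : ℕ → ℝ
  | 0 => 0
  | n + 1 => level ρ r n + excess ρ r (level ρ r n)

theorem excess_nonneg (ρ : Measure 𝒴) (r : 𝒴 → ℝ) (l : ℝ) : 0 ≤ excess ρ r l :=
  ENNReal.toReal_nonneg

theorem level_nonneg (ρ : Measure 𝒴) (r : 𝒴 → ℝ) (n : ℕ) : 0 ≤ level ρ r n := by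
  induction n with
  | zero => exact le_rfl
  | succ n ih => exact add_nonneg ih (excess_nonneg _ _ _)

theorem level_mono (ρ : Measure 𝒴) (r : 𝒴 → ℝ) : Monotone (level ρ r) :=
  monotone_nat_of_le_succ fun _ => le_add_of_nonneg_right (excess_nonneg _ _ _)

variable {ρ : Measure 𝒴} {r : 𝒴 → ℝ}

theorem lintegral_sub_le_one (h1 : ∫⁻ y, ENNReal.ofReal (r y) ∂ρ = 1) {l : ℝ} (hl : 0 ≤ l) :
    ∫⁻ y, ENNReal.ofReal (r y - l) ∂ρ ≤ 1 := by
  rw [← h1]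
  exact lintegral_mono fun y => ENNReal.ofReal_le_ofReal (by linarith)

theorem ofReal_excess (h1 : ∫⁻ y, ENNReal.ofReal (r y) ∂ρ = 1) {l : ℝ} (hl : 0 ≤ l) :
    ENNReal.ofReal (excess ρ r l) = ∫⁻ y, ENNReal.ofReal (r y - l) ∂ρ :=
  ENNReal.ofReal_toReal ((lintegral_sub_le_one h1 hl).trans_lt ENNReal.one_lt_top).ne

theorem excess_le_one (h1 : ∫⁻ y, ENNReal.ofReal (r y) ∂ρ = 1) {l : ℝ} (hl : 0 ≤ l) :
    excess ρ r l ≤ 1 :=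
  ENNReal.toReal_le_of_le_ofReal zero_le_one (by simpa using lintegral_sub_le_one h1 hl)

theorem excess_zero (h1 : ∫⁻ y, ENNReal.ofReal (r y) ∂ρ = 1) : excess ρ r 0 = 1 := by
  simp [excess, h1]

theorem excess_anti (h1 : ∫⁻ y, ENNReal.ofReal (r y) ∂ρ = 1) {a b : ℝ} (ha : 0 ≤ a)
    (hab : a ≤ b) : excess ρ r b ≤ excess ρ r a := by
  rw [← ENNReal.ofReal_le_ofReal_iff (excess_nonneg _ _ _), ofReal_excess h1 ha,
    ofReal_excess h1 (ha.trans hab)]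
  exact lintegral_mono fun y => ENNReal.ofReal_le_ofReal (by linarith)

/-- The law of `(Y, V)` for `Y` with density `r` and an independent uniform `V`. The level of the
accepted point is distributed as `V * r Y`. -/
def levelMeasure (ρ : Measure 𝒴) (r : 𝒴 → ℝ) : Measure (𝒴 × ℝ) :=
  (ρ.withDensity fun y => ENNReal.ofReal (r y)).prod (volume.restrict (Ioc 0 1))

theorem isProbabilityMeasure_withDensity_ofReal (h1 : ∫⁻ y, ENNReal.ofReal (r y) ∂ρ = 1) :
    IsProbabilityMeasure (ρ.withDensity fun y => ENNReal.ofReal (r y)) :=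
  ⟨by rw [withDensity_apply _ MeasurableSet.univ, Measure.restrict_univ, h1]⟩

theorem isProbabilityMeasure_volume_Ioc :
    IsProbabilityMeasure ((volume : Measure ℝ).restrict (Ioc 0 1)) :=
  ⟨by simp⟩

theorem isProbabilityMeasure_levelMeasure (h1 : ∫⁻ y, ENNReal.ofReal (r y) ∂ρ = 1) :
    IsProbabilityMeasure (levelMeasure ρ r) := by
  have := isProbabilityMeasure_withDensity_ofReal h1
  have := isProbabilityMeasure_volume_Ioc
  rw [levelMeasure]; infer_instance

theorem excess_le_add [IsProbabilityMeasure ρ]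
    (h1 : ∫⁻ y, ENNReal.ofReal (r y) ∂ρ = 1) {a b : ℝ} (ha : 0 ≤ a)
    (hab : a ≤ b) : excess ρ r a ≤ excess ρ r b + (b - a) := by
  have hb := ha.trans hab
  rw [← ENNReal.ofReal_le_ofReal_iff (add_nonneg (excess_nonneg _ _ _) (by linarith)),
    ENNReal.ofReal_add (excess_nonneg _ _ _) (by linarith), ofReal_excess h1 ha,
    ofReal_excess h1 hb]
  calc ∫⁻ y, ENNReal.ofReal (r y - a) ∂ρ
      ≤ ∫⁻ y, (ENNReal.ofReal (r y - b) + ENNReal.ofReal (b - a)) ∂ρ :=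
        lintegral_mono fun y =>
          le_trans (ENNReal.ofReal_le_ofReal (by linarith)) ENNReal.ofReal_add_le
    _ = _ := by rw [lintegral_add_right _ measurable_const]; simp

theorem one_sub_le_excess [IsProbabilityMeasure ρ]
    (h1 : ∫⁻ y, ENNReal.ofReal (r y) ∂ρ = 1) {l : ℝ} (hl : 0 ≤ l) :
    1 - l ≤ excess ρ r l := by
  have := excess_le_add h1 le_rfl hl
  rw [excess_zero h1] at this
  linarith

theorem continuousOn_excess [IsProbabilityMeasure ρ] (h1 : ∫⁻ y, ENNReal.ofReal (r y) ∂ρ = 1) :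
    ContinuousOn (excess ρ r) (Ici 0) := by
  have : LipschitzOnWith 1 (excess ρ r) (Ici 0) := by
    refine LipschitzOnWith.of_dist_le_mul fun a ha b hb => ?_
    rw [NNReal.coe_one, one_mul, Real.dist_eq, Real.dist_eq, abs_le]
    rcases le_total a b with hab | hab
    · rw [abs_of_nonpos (by linarith)]
      have := excess_le_add h1 ha hab
      have := excess_anti h1 ha hab
      constructor <;> linarith
    · rw [abs_of_nonneg (by linarith)]
      have := excess_le_add h1 hb hab
      have := excess_anti h1 hb hab
      constructor <;> linarith
  exact this.continuousOn

theorem tendsto_excess (hr : Measurable r) (h1 : ∫⁻ y, ENNReal.ofReal (r y) ∂ρ = 1) :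
    Tendsto (excess ρ r) atTop (𝓝 0) := by
  have h : Tendsto (fun l => ∫⁻ y, ENNReal.ofReal (r y - l) ∂ρ) atTop (𝓝 (∫⁻ _, 0 ∂ρ)) := by
    refine tendsto_lintegral_filter_of_dominated_convergence (fun y => ENNReal.ofReal (r y))
      (Eventually.of_forall fun l => (hr.sub_const l).ennreal_ofReal)
      ((eventually_ge_atTop 0).mono fun l hl => ae_of_all _ fun y =>
        ENNReal.ofReal_le_ofReal (by linarith)) (by simp [h1]) (ae_of_all _ fun y => ?_)
    refine tendsto_const_nhds.congr' ?_
    filter_upwards [eventually_ge_atTop (r y)] with l hl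
    rw [ENNReal.ofReal_of_nonpos (by linarith)]
  rw [lintegral_zero] at h
  exact (ENNReal.tendsto_toReal ENNReal.zero_ne_top).comp h

theorem exists_excess_eq [IsProbabilityMeasure ρ]
    (hr : Measurable r) (h1 : ∫⁻ y, ENNReal.ofReal (r y) ∂ρ = 1) {u : ℝ}
    (hu : 0 < u) (hu' : u ≤ 1) : ∃ l, 0 ≤ l ∧ excess ρ r l = u := by
  obtain ⟨b, hb0, hb⟩ := ((eventually_ge_atTop 0).and
    ((tendsto_excess hr h1).eventually (gt_mem_nhds hu))).exists
  obtain ⟨l, hl, h⟩ := intermediate_value_Icc' hb0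
    ((continuousOn_excess h1).mono Icc_subset_Ici_self)
    (show u ∈ Icc (excess ρ r b) (excess ρ r 0) by rw [excess_zero h1]; exact ⟨hb.le, hu'⟩)
  exact ⟨l, hl.1, h⟩

theorem nat_mul_excess_level_le (h1 : ∫⁻ y, ENNReal.ofReal (r y) ∂ρ = 1) (n : ℕ) :
    n * excess ρ r (level ρ r n) ≤ level ρ r n := by
  induction n with
  | zero => simp [level]
  | succ n ih =>
    have h := excess_anti h1 (level_nonneg ρ r n) (level_mono ρ r n.le_succ)
    have hn : (n : ℝ) * excess ρ r (level ρ r (n + 1)) ≤ n * excess ρ r (level ρ r n) :=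
      mul_le_mul_of_nonneg_left h n.cast_nonneg
    have : level ρ r (n + 1) = level ρ r n + excess ρ r (level ρ r n) := rfl
    push_cast
    linarith

theorem tendsto_excess_level (hr : Measurable r) (h1 : ∫⁻ y, ENNReal.ofReal (r y) ∂ρ = 1) :
    Tendsto (fun n => excess ρ r (level ρ r n)) atTop (𝓝 0) := by
  rw [Metric.tendsto_atTop]
  intro ε hε
  obtain ⟨b, hb0, hb⟩ := ((eventually_ge_atTop 0).and
    ((tendsto_excess hr h1).eventually (gt_mem_nhds hε))).exists
  obtain ⟨N, hN⟩ := exists_nat_gt (b / ε)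
  refine ⟨N, fun n hn => ?_⟩
  rw [Real.dist_0_eq_abs, abs_of_nonneg (excess_nonneg _ _ _)]
  by_contra! hge
  have hNb : b < N * ε := (div_lt_iff₀ hε).1 hN
  have hn' : (N : ℝ) ≤ n := by exact_mod_cast hn
  have h := nat_mul_excess_level_le h1 n
  have hlev : b ≤ level ρ r n := by
    have : (N : ℝ) * ε ≤ n * excess ρ r (level ρ r n) :=
      mul_le_mul hn' hge hε.le n.cast_nonneg
    linarith
  exact absurd (hge.trans (excess_anti h1 hb0 hlev)) (not_le.2 hb)

/-- `(min c s)⁺` is `s` times the probability that a uniform `u` satisfies `u s < c`. -/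
theorem ofReal_mul_volume_add (s c : ℝ) (hs : 0 ≤ s) :
    ENNReal.ofReal s * volume (Ioc (0 : ℝ) 1 ∩ {u | u * s < c}) + ENNReal.ofReal (c - s)
      = ENNReal.ofReal c := by
  rcases hs.eq_or_lt with rfl | hs
  · simp
  have hset : {u : ℝ | u * s < c} = Iio (c / s) := by
    ext u; simp [lt_div_iff₀ hs]
  rw [hset]
  rcases le_or_gt c 0 with hc | hc
  · have : Ioc (0 : ℝ) 1 ∩ Iio (c / s) = ∅ := by
      ext u
      simp only [mem_inter_iff, mem_Ioc, mem_Iio, mem_empty_iff_false, iff_false, not_and]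
      intro hu h
      linarith [div_nonpos_of_nonpos_of_nonneg hc hs.le]
    rw [this, ENNReal.ofReal_of_nonpos hc,
      ENNReal.ofReal_of_nonpos (p := c - s) (by linarith)]
    simp
  rcases le_or_gt c s with hcs | hcs
  · have : Ioc (0 : ℝ) 1 ∩ Iio (c / s) = Ioo 0 (c / s) := by
      ext u
      have : c / s ≤ 1 := (div_le_one hs).2 hcs
      simp only [mem_inter_iff, mem_Ioc, mem_Iio, mem_Ioo]
      constructor
      · rintro ⟨h, h'⟩; exact ⟨h.1, h'⟩
      · rintro ⟨h, h'⟩; exact ⟨⟨h, by linarith⟩, h'⟩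
    rw [this, Real.volume_Ioo, ENNReal.ofReal_of_nonpos (p := c - s) (by linarith), add_zero,
      ← ENNReal.ofReal_mul hs.le, sub_zero, mul_div_cancel₀ _ hs.ne']
  · have : Ioc (0 : ℝ) 1 ∩ Iio (c / s) = Ioc 0 1 := by
      have : 1 < c / s := (one_lt_div hs).2 hcs
      refine inter_eq_left.2 fun u hu => lt_of_le_of_lt hu.2 this
    rw [this, Real.volume_Ioc, sub_zero, ENNReal.ofReal_one, mul_one,
      ← ENNReal.ofReal_add hs.le (by linarith)]
    congr 1; ring

theorem levelMeasure_lt_add (hr : Measurable r) (h0 : ∀ y, 0 ≤ r y)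
    (h1 : ∫⁻ y, ENNReal.ofReal (r y) ∂ρ = 1) {a : ℝ} (ha : 0 ≤ a) :
    levelMeasure ρ r {p | p.2 * r p.1 < a} + ENNReal.ofReal (excess ρ r a) = 1 := by
  have hs : MeasurableSet {p : 𝒴 × ℝ | p.2 * r p.1 < a} :=
    measurableSet_lt (by fun_prop) measurable_const
  rw [levelMeasure, Measure.prod_apply hs, ofReal_excess h1 ha,
    lintegral_withDensity_eq_lintegral_mul _ (by fun_prop) (measurable_measure_prodMk_left hs),
    ← lintegral_add_right _ (by fun_prop), ← h1]
  refine lintegral_congr fun y => ?_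
  have h := ofReal_mul_volume_add (r y) a (h0 y)
  have hset : MeasurableSet {u : ℝ | u * r y < a} := measurableSet_lt (by fun_prop) measurable_const
  rw [Pi.mul_apply]
  change ENNReal.ofReal (r y) * (volume.restrict (Ioc (0 : ℝ) 1)) {u | u * r y < a} + _ = _
  rw [Measure.restrict_apply hset, inter_comm]
  rcases le_total a (r y) with hay | hay
  · rw [ENNReal.ofReal_of_nonpos (p := a - r y) (by linarith), add_zero] at h
    rw [h, ← ENNReal.ofReal_add ha (by linarith)]
    congr 1; ring
  · rw [ENNReal.ofReal_of_nonpos (p := r y - a) (by linarith), add_zero]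
    refine (ENNReal.add_left_inj (ENNReal.ofReal_ne_top (r := a - r y))).1 ?_
    rw [h, ← ENNReal.ofReal_add (h0 y) (by linarith)]
    congr 1; ring

theorem levelMeasure_ge (hr : Measurable r) (h0 : ∀ y, 0 ≤ r y)
    (h1 : ∫⁻ y, ENNReal.ofReal (r y) ∂ρ = 1) {a : ℝ} (ha : 0 ≤ a) :
    levelMeasure ρ r {p | a ≤ p.2 * r p.1} = ENNReal.ofReal (excess ρ r a) := by
  have := isProbabilityMeasure_levelMeasure h1
  have hs : MeasurableSet {p : 𝒴 × ℝ | p.2 * r p.1 < a} :=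
    measurableSet_lt (by fun_prop) measurable_const
  have h := levelMeasure_lt_add hr h0 h1 ha
  rw [← measure_univ (μ := levelMeasure ρ r), ← measure_add_measure_compl hs,
    ENNReal.add_right_inj (measure_ne_top _ _)] at h
  rw [h]
  congr 1
  ext p; simp

theorem levelMeasure_lt (hr : Measurable r) (h0 : ∀ y, 0 ≤ r y)
    (h1 : ∫⁻ y, ENNReal.ofReal (r y) ∂ρ = 1) {a : ℝ} (ha : 0 ≤ a) :
    levelMeasure ρ r {p | p.2 * r p.1 < a} = ENNReal.ofReal (1 - excess ρ r a) := by
  refine (ENNReal.add_left_inj (ENNReal.ofReal_ne_top (r := excess ρ r a))).1 ?_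
  rw [levelMeasure_lt_add hr h0 h1 ha, ← ENNReal.ofReal_add
    (by linarith [excess_le_one h1 ha]) (excess_nonneg _ _ _)]
  simp

theorem levelMeasure_excess_lt [IsProbabilityMeasure ρ] (hr : Measurable r) (h0 : ∀ y, 0 ≤ r y)
    (h1 : ∫⁻ y, ENNReal.ofReal (r y) ∂ρ = 1) {u : ℝ} (hu : 0 < u) (hu' : u ≤ 1) :
    levelMeasure ρ r {p | excess ρ r (p.2 * r p.1) < u} ≤ ENNReal.ofReal u := by
  obtain ⟨l, hl0, rfl⟩ := exists_excess_eq hr h1 hu hu'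
  rw [← levelMeasure_ge hr h0 h1 hl0]
  refine measure_mono_ae ?_
  have hv : ∀ᵐ p ∂(levelMeasure ρ r), 0 ≤ p.2 * r p.1 := by
    have := levelMeasure_ge hr h0 h1 le_rfl
    have hP := isProbabilityMeasure_levelMeasure h1
    rw [excess_zero h1, ENNReal.ofReal_one] at this
    exact (prob_compl_eq_zero_iff
      (measurableSet_le measurable_const (by fun_prop))).2 this
  filter_upwards [hv] with p hp hlt
  by_contra hge
  exact absurd (excess_anti h1 hp (not_le.1 hge).le) (not_le.2 hlt)

theorem levelMeasure_lt_excess [IsProbabilityMeasure ρ] (hr : Measurable r) (h0 : ∀ y, 0 ≤ r y)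
    (h1 : ∫⁻ y, ENNReal.ofReal (r y) ∂ρ = 1) {u : ℝ} (hu : 0 ≤ u) (hu' : u < 1) :
    levelMeasure ρ r {p | 1 - u < excess ρ r (p.2 * r p.1)} ≤ ENNReal.ofReal u := by
  obtain ⟨l, hl0, hl⟩ := exists_excess_eq (u := 1 - u) hr h1 (by linarith) (by linarith)
  rw [show u = 1 - excess ρ r l by linarith, ← levelMeasure_lt hr h0 h1 hl0]
  refine measure_mono fun p hlt => ?_
  simp only [mem_ofPred_eq, sub_sub_cancel] at hlt ⊢
  by_contra hge
  exact absurd (excess_anti h1 hl0 (not_lt.1 hge)) (not_le.2 hlt)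

/-- A random variable with a tail below the standard exponential tail has mean at most one. -/
theorem lintegral_ofReal_le_one {α : Type*} [MeasurableSpace α] (ν : Measure α) {W : α → ℝ}
    (hW : AEMeasurable W ν) (h0 : 0 ≤ᵐ[ν] W)
    (ht : ∀ t, 0 < t → ν {a | t < W a} ≤ ENNReal.ofReal (Real.exp (-t))) :
    ∫⁻ a, ENNReal.ofReal (W a) ∂ν ≤ 1 := by
  rw [lintegral_eq_lintegral_meas_lt ν h0 hW]
  calc ∫⁻ t in Ioi 0, ν {a | t < W a}
      ≤ ∫⁻ t in Ioi (0 : ℝ), ENNReal.ofReal (Real.exp (-t)) :=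
        setLIntegral_mono (by fun_prop) fun t h => ht t h
    _ = ENNReal.ofReal (∫ t in Ioi (0 : ℝ), Real.exp (-t)) :=
        (ofReal_integral_eq_lintegral_ofReal (integrableOn_exp_neg_Ioi 0)
          (ae_of_all _ fun t => (Real.exp_pos _).le)).symm
    _ = 1 := by rw [integral_exp_neg_Ioi]; simp

end Excess

/-! ### The mean logarithm of the number of rounds -/

section LevelLog

open Filter Topology Set

variable {𝒴 : Type*} [MeasurableSpace 𝒴] {ρ : Measure 𝒴} {r : 𝒴 → ℝ}

/-- If `t` lies above level `n`, then `n + 1 ≤ t / (G (1 - G))` for `G = excess ρ r t`. -/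
theorem log_succ_le [IsProbabilityMeasure ρ] (h1 : ∫⁻ y, ENNReal.ofReal (r y) ∂ρ = 1) {n : ℕ}
    {t : ℝ} (ht : level ρ r n ≤ t) (hG0 : 0 < excess ρ r t) (hG1 : excess ρ r t < 1) :
    Real.log (n + 1) ≤
      Real.log t + (-Real.log (excess ρ r t) + -Real.log (1 - excess ρ r t)) := by
  have ht0 : 0 ≤ t := (level_nonneg ρ r n).trans ht
  have hn : (n : ℝ) * excess ρ r t ≤ t :=
    (mul_le_mul_of_nonneg_left (excess_anti h1 (level_nonneg ρ r n) ht) n.cast_nonneg).trans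
      ((nat_mul_excess_level_le h1 n).trans ht)
  have hl := one_sub_le_excess h1 ht0
  set G := excess ρ r t
  have ht' : 0 < t := by linarith
  have hprod : (n + 1 : ℝ) * (G * (1 - G)) ≤ t := by
    have : (n + 1 : ℝ) * G * (1 - G) ≤ (t + G) * (1 - G) :=
      mul_le_mul_of_nonneg_right (by linarith) (by linarith)
    nlinarith [mul_nonneg hG0.le (show 0 ≤ t - (1 - G) by linarith)]
  have hlog := Real.log_le_log (by have := sub_pos.2 hG1; positivity) hprod
  rw [Real.log_mul (by positivity) (mul_pos hG0 (sub_pos.2 hG1)).ne',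
    Real.log_mul hG0.ne' (sub_pos.2 hG1).ne'] at hlog
  linarith

theorem measurable_excess [SFinite ρ] (hr : Measurable r) : Measurable (excess ρ r) := by
  refine Measurable.ennreal_toReal ?_
  exact Measurable.lintegral_prod_right' (f := fun p : ℝ × 𝒴 => ENNReal.ofReal (r p.2 - p.1))
    (by fun_prop)

theorem levelMeasure_ae_pos (hr : Measurable r) (h1 : ∫⁻ y, ENNReal.ofReal (r y) ∂ρ = 1) :
    ∀ᵐ p ∂(levelMeasure ρ r), 0 < r p.1 ∧ 0 < p.2 := by
  have := isProbabilityMeasure_withDensity_ofReal h1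
  have := isProbabilityMeasure_volume_Ioc
  have h₁ : ∀ᵐ y ∂(ρ.withDensity fun y => ENNReal.ofReal (r y)), 0 < r y := by
    rw [ae_withDensity_iff (by fun_prop)]
    exact ae_of_all _ fun y hy => ENNReal.ofReal_pos.1 (pos_iff_ne_zero.2 hy)
  have h₂ : ∀ᵐ v ∂((volume : Measure ℝ).restrict (Ioc 0 1)), 0 < v :=
    (ae_restrict_mem measurableSet_Ioc).mono fun v hv => hv.1
  exact (Measure.quasiMeasurePreserving_fst.ae h₁).and (Measure.quasiMeasurePreserving_snd.ae h₂)

theorem levelMeasure_ae_excess [IsProbabilityMeasure ρ] (hr : Measurable r) (h0 : ∀ y, 0 ≤ r y)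
    (h1 : ∫⁻ y, ENNReal.ofReal (r y) ∂ρ = 1) :
    ∀ᵐ p ∂(levelMeasure ρ r), 0 < excess ρ r (p.2 * r p.1) ∧ excess ρ r (p.2 * r p.1) < 1 := by
  have key : ∀ c : ℝ≥0∞, (∀ u : ℝ, 0 < u → u < 1 → c ≤ ENNReal.ofReal u) → c = 0 := by
    intro c hc
    by_contra hne
    obtain ⟨u, hu0, hu⟩ := ENNReal.lt_iff_exists_real_btwn.1 (pos_iff_ne_zero.2 hne)
    have hu' : 0 < u := ENNReal.ofReal_pos.1 hu.1
    have h := hc (min u (1 / 2)) (by positivity) (by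
      exact lt_of_le_of_lt (min_le_right _ _) (by norm_num))
    exact absurd (h.trans (ENNReal.ofReal_le_ofReal (min_le_left _ _))) (not_le.2 hu.2)
  refine Eventually.and ?_ ?_
  · rw [ae_iff]
    refine key _ fun u hu0 hu1 => le_trans (measure_mono fun p hp => ?_)
      (levelMeasure_excess_lt hr h0 h1 hu0 hu1.le)
    exact (not_lt.1 hp).trans_lt hu0
  · rw [ae_iff]
    refine key _ fun u hu0 hu1 => le_trans (measure_mono fun p hp => ?_)
      (levelMeasure_lt_excess hr h0 h1 hu0.le hu1)
    have : 1 ≤ excess ρ r (p.2 * r p.1) := not_lt.1 hp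
    exact (by linarith : 1 - u < excess ρ r (p.2 * r p.1))

theorem integrable_log_Ioc : Integrable Real.log (volume.restrict (Ioc (0 : ℝ) 1)) :=
  (intervalIntegrable_iff_integrableOn_Ioc_of_le zero_le_one).1
    intervalIntegral.intervalIntegrable_log'

theorem integral_log_Ioc : ∫ v in Ioc (0 : ℝ) 1, Real.log v = -1 := by
  rw [← intervalIntegral.integral_of_le zero_le_one, integral_log]
  simp

/-- With `t` the level of the accepted point, `E log t = D - 1`, because `t` is uniform below
`r Y`. -/
theorem integral_log_level (hr : Measurable r) (h0 : ∀ y, 0 ≤ r y)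
    (h1 : ∫⁻ y, ENNReal.ofReal (r y) ∂ρ = 1)
    (hint : Integrable (fun y => r y * Real.log (r y)) ρ) :
    Integrable (fun p => Real.log (p.2 * r p.1)) (levelMeasure ρ r) ∧
      ∫ p, Real.log (p.2 * r p.1) ∂(levelMeasure ρ r) = ∫ y, r y * Real.log (r y) ∂ρ - 1 := by
  have := isProbabilityMeasure_withDensity_ofReal h1
  have := isProbabilityMeasure_volume_Ioc
  have hcongr : (fun p : 𝒴 × ℝ => Real.log (p.2 * r p.1)) =ᵐ[levelMeasure ρ r]
      fun p => Real.log (r p.1) + Real.log p.2 := by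
    filter_upwards [levelMeasure_ae_pos hr h1] with p hp
    rw [Real.log_mul hp.2.ne' hp.1.ne', add_comm]
  have hsm : (fun y => (ENNReal.ofReal (r y)).toReal • Real.log (r y))
      = fun y => r y * Real.log (r y) := by
    ext y; rw [ENNReal.toReal_ofReal (h0 y), smul_eq_mul]
  have hi1 : Integrable (fun y => Real.log (r y))
      (ρ.withDensity fun y => ENNReal.ofReal (r y)) := by
    rw [integrable_withDensity_iff_integrable_smul' (by fun_prop) (by simp), hsm]
    exact hint
  have hv1 : ∫ y, Real.log (r y) ∂(ρ.withDensity fun y => ENNReal.ofReal (r y))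
      = ∫ y, r y * Real.log (r y) ∂ρ := by
    rw [integral_withDensity_eq_integral_toReal_smul (by fun_prop) (by simp), hsm]
  have hf : Integrable (fun p : 𝒴 × ℝ => Real.log (r p.1)) (levelMeasure ρ r) := hi1.comp_fst _
  have hs : Integrable (fun p : 𝒴 × ℝ => Real.log p.2) (levelMeasure ρ r) :=
    integrable_log_Ioc.comp_snd _
  refine ⟨(integrable_congr hcongr).2 (hf.add hs), ?_⟩
  rw [integral_congr_ae hcongr, integral_add hf hs]
  have e1 : ∫ p, Real.log (r p.1) ∂(levelMeasure ρ r) = ∫ y, r y * Real.log (r y) ∂ρ := by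
    rw [← hv1, levelMeasure, integral_fun_fst (f := fun y => Real.log (r y))]
    simp
  have e2 : ∫ p, Real.log p.2 ∂(levelMeasure ρ r) = -1 := by
    rw [← integral_log_Ioc, levelMeasure, integral_fun_snd (f := fun v => Real.log v)]
    simp
  rw [e1, e2]; ring

/-- With `t` the level of the accepted point and `G = excess ρ r t`, both `G` and `1 - G` are
uniform on `[0, 1]`, so that `-log G` and `-log (1 - G)` have mean at most `1`. -/
theorem lintegral_log_le [IsProbabilityMeasure ρ] (hr : Measurable r) (h0 : ∀ y, 0 ≤ r y)
    (h1 : ∫⁻ y, ENNReal.ofReal (r y) ∂ρ = 1)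
    (hint : Integrable (fun y => r y * Real.log (r y)) ρ) :
    ∫⁻ p, ENNReal.ofReal (Real.log (p.2 * r p.1) + (-Real.log (excess ρ r (p.2 * r p.1)) +
        -Real.log (1 - excess ρ r (p.2 * r p.1)))) ∂(levelMeasure ρ r)
      ≤ ENNReal.ofReal (∫ y, r y * Real.log (r y) ∂ρ + 1) := by
  have hm : Measurable fun p : 𝒴 × ℝ => excess ρ r (p.2 * r p.1) :=
    (measurable_excess hr).comp (by fun_prop)
  set t : 𝒴 × ℝ → ℝ := fun p => p.2 * r p.1 with ht
  have hpos := levelMeasure_ae_excess hr h0 h1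
  have hlpos := levelMeasure_ae_pos hr h1
  have hW1m : Measurable fun p => -Real.log (excess ρ r (t p)) := by fun_prop
  have hW2m : Measurable fun p => -Real.log (1 - excess ρ r (t p)) := by fun_prop
  have hW1n : 0 ≤ᵐ[levelMeasure ρ r] fun p => -Real.log (excess ρ r (t p)) := by
    filter_upwards [hpos] with p hp
    exact neg_nonneg.2 (Real.log_nonpos hp.1.le hp.2.le)
  have hW2n : 0 ≤ᵐ[levelMeasure ρ r] fun p => -Real.log (1 - excess ρ r (t p)) := by
    filter_upwards [hpos] with p hp
    exact neg_nonneg.2 (Real.log_nonpos (by linarith) (by linarith [hp.1]))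
  have hlt : ∀ {x s : ℝ}, 0 < s → s < -Real.log x → 0 ≤ x → x < Real.exp (-s) := by
    intro x s hs h hx
    rcases hx.eq_or_lt with rfl | hx
    · exact Real.exp_pos _
    · exact (Real.log_lt_iff_lt_exp hx).1 (by linarith)
  have hW1 : ∫⁻ p, ENNReal.ofReal (-Real.log (excess ρ r (t p))) ∂(levelMeasure ρ r) ≤ 1 := by
    refine lintegral_ofReal_le_one _ hW1m.aemeasurable hW1n fun s hs => ?_
    refine le_trans (measure_mono fun p hp => ?_) (levelMeasure_excess_lt hr h0 h1
      (Real.exp_pos (-s)) (Real.exp_le_one_iff.2 (by linarith)))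
    exact hlt hs hp (excess_nonneg _ _ _)
  have hW2 : ∫⁻ p, ENNReal.ofReal (-Real.log (1 - excess ρ r (t p))) ∂(levelMeasure ρ r) ≤ 1 := by
    refine lintegral_ofReal_le_one _ hW2m.aemeasurable hW2n fun s hs => ?_
    refine le_trans (measure_mono_ae ?_) (levelMeasure_lt_excess hr h0 h1
      (Real.exp_pos (-s)).le (Real.exp_lt_one_iff.2 (by linarith)))
    filter_upwards [hpos] with p hp hps
    have := hlt hs hps (by linarith [hp.2])
    exact (by linarith : 1 - Real.exp (-s) < excess ρ r (t p))
  have hI : ∀ {W : 𝒴 × ℝ → ℝ}, Measurable W → 0 ≤ᵐ[levelMeasure ρ r] W →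
      ∫⁻ p, ENNReal.ofReal (W p) ∂(levelMeasure ρ r) ≤ 1 →
      Integrable W (levelMeasure ρ r) ∧ ∫ p, W p ∂(levelMeasure ρ r) ≤ 1 := by
    intro W hWm hWn hW
    refine ⟨(lintegral_ofReal_ne_top_iff_integrable hWm.aestronglyMeasurable hWn).1
      (hW.trans_lt ENNReal.one_lt_top).ne, ?_⟩
    rw [integral_eq_lintegral_of_nonneg_ae hWn hWm.aestronglyMeasurable]
    exact ENNReal.toReal_le_of_le_ofReal zero_le_one (by simpa using hW)
  obtain ⟨i1, b1⟩ := hI hW1m hW1n hW1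
  obtain ⟨i2, b2⟩ := hI hW2m hW2n hW2
  obtain ⟨i0, b0⟩ := integral_log_level hr h0 h1 hint
  rw [← ofReal_integral_eq_lintegral_ofReal (f := fun p => Real.log (t p) +
    (-Real.log (excess ρ r (t p)) + -Real.log (1 - excess ρ r (t p)))) (i0.add (i1.add i2))]
  · refine ENNReal.ofReal_le_ofReal ?_
    have : ∫ p, (Real.log (t p) + (-Real.log (excess ρ r (t p)) +
        -Real.log (1 - excess ρ r (t p)))) ∂(levelMeasure ρ r)
        = ∫ p, Real.log (t p) ∂(levelMeasure ρ r) +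
          (∫ p, -Real.log (excess ρ r (t p)) ∂(levelMeasure ρ r) +
            ∫ p, -Real.log (1 - excess ρ r (t p)) ∂(levelMeasure ρ r)) := by
      rw [← integral_add i1 i2]
      exact integral_add i0 (i1.add i2)
    refine le_trans (le_of_eq this) ?_
    have b0' : ∫ p, Real.log (t p) ∂(levelMeasure ρ r) = ∫ y, r y * Real.log (r y) ∂ρ - 1 := b0
    linarith
  · filter_upwards [hpos, hlpos] with p hp hp'
    have h := log_succ_le h1 (n := 0) (t := t p) (mul_pos hp'.2 hp'.1).le hp.1 hp.2
    simpa using h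

/-- The number `n + 1` of rounds of greedy rejection sampling satisfies `E log (n + 1) ≤ D + 1`
(in nats), where `D = ∫ r log r dρ`. -/
theorem tsum_log_mul_le [IsProbabilityMeasure ρ] (hr : Measurable r) (h0 : ∀ y, 0 ≤ r y)
    (h1 : ∫⁻ y, ENNReal.ofReal (r y) ∂ρ = 1)
    (hint : Integrable (fun y => r y * Real.log (r y)) ρ) :
    ∑' n : ℕ, ENNReal.ofReal (Real.log (n + 1)) *
        ENNReal.ofReal (excess ρ r (level ρ r n) - excess ρ r (level ρ r (n + 1)))
      ≤ ENNReal.ofReal (∫ y, r y * Real.log (r y) ∂ρ + 1) := by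
  refine le_trans ?_ (lintegral_log_le hr h0 h1 hint)
  have hP := isProbabilityMeasure_levelMeasure h1
  have htm : Measurable fun p : 𝒴 × ℝ => p.2 * r p.1 := by fun_prop
  set S : ℕ → Set (𝒴 × ℝ) := fun n =>
    (fun p : 𝒴 × ℝ => p.2 * r p.1) ⁻¹' Ico (level ρ r n) (level ρ r (n + 1)) with hS
  have hSm : ∀ n, MeasurableSet (S n) := fun n => htm measurableSet_Ico
  have hSd : Pairwise (Function.onFun Disjoint S) := by
    intro i j hij
    refine Disjoint.preimage _ ?_
    exact (level_mono ρ r).pairwise_disjoint_on_Ico_succ hij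
  have hSμ : ∀ n, levelMeasure ρ r (S n)
      = ENNReal.ofReal (excess ρ r (level ρ r n) - excess ρ r (level ρ r (n + 1))) := by
    intro n
    have hsub : S n = {p | level ρ r n ≤ p.2 * r p.1} \ {p | level ρ r (n + 1) ≤ p.2 * r p.1} := by
      ext p; simp [hS]
    have hle : {p : 𝒴 × ℝ | level ρ r (n + 1) ≤ p.2 * r p.1} ⊆ {p | level ρ r n ≤ p.2 * r p.1} :=
      fun p hp => (level_mono ρ r n.le_succ).trans hp
    rw [hsub, measure_sdiff hle (measurableSet_le measurable_const htm).nullMeasurableSet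
        (measure_ne_top _ _),
      levelMeasure_ge hr h0 h1 (level_nonneg ρ r n),
      levelMeasure_ge hr h0 h1 (level_nonneg ρ r (n + 1)),
      ENNReal.ofReal_sub _ (excess_nonneg _ _ _)]
  calc _ = ∑' n : ℕ, ∫⁻ p in S n, ENNReal.ofReal (Real.log (n + 1)) ∂(levelMeasure ρ r) := by
        refine tsum_congr fun n => ?_
        rw [setLIntegral_const, hSμ]
    _ ≤ ∑' n : ℕ, ∫⁻ p in S n, ENNReal.ofReal (Real.log (p.2 * r p.1) +
          (-Real.log (excess ρ r (p.2 * r p.1)) + -Real.log (1 - excess ρ r (p.2 * r p.1))))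
          ∂(levelMeasure ρ r) := by
        refine ENNReal.tsum_le_tsum fun n => setLIntegral_mono_ae' (hSm n) ?_
        filter_upwards [levelMeasure_ae_excess hr h0 h1] with p hp hpS
        exact ENNReal.ofReal_le_ofReal (log_succ_le h1 hpS.1 hp.1 hp.2)
    _ = ∫⁻ p in ⋃ n, S n, ENNReal.ofReal (Real.log (p.2 * r p.1) +
          (-Real.log (excess ρ r (p.2 * r p.1)) + -Real.log (1 - excess ρ r (p.2 * r p.1))))
          ∂(levelMeasure ρ r) := (lintegral_iUnion hSm hSd _).symm
    _ ≤ _ := setLIntegral_le_lintegral _ _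

end LevelLog

/-! ### The sampling process -/

section Sampling

open Filter Topology Set

variable {𝒴 : Type*} [MeasurableSpace 𝒴] {ρ : Measure 𝒴} {r : 𝒴 → ℝ}

/-- The law of a proposal `(y, u)`: `y` is drawn from `ρ`, and `u` is an independent uniform. -/
def proposal (ρ : Measure 𝒴) : Measure (𝒴 × ℝ) := ρ.prod (volume.restrict (Ioc 0 1))

/-- The proposals accepted in round `n`, if this round is reached: `(y, u)` is accepted if the
uniformly chosen level between `level ρ r n` and `level ρ r (n + 1)` is below `r y`. -/
def acceptSet (ρ : Measure 𝒴) (r : 𝒴 → ℝ) (n : ℕ) : Set (𝒴 × ℝ) :=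
  {e | e.2 * excess ρ r (level ρ r n) < r e.1 - level ρ r n}

/-- The first round in which the proposal is accepted (`0` if there is none). -/
def acceptTime (ρ : Measure 𝒴) (r : 𝒴 → ℝ) (z : ℕ → 𝒴 × ℝ) : ℕ :=
  sInf {n | z n ∈ acceptSet ρ r n}

/-- The event that a point of `B` is accepted in round `n`, and nothing before. -/
def acceptEvent (ρ : Measure 𝒴) (r : 𝒴 → ℝ) (n : ℕ) (B : Set 𝒴) : Set (ℕ → 𝒴 × ℝ) :=
  {z | (∀ j < n, z j ∉ acceptSet ρ r j) ∧ z n ∈ acceptSet ρ r n ∧ (z n).1 ∈ B}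

instance (ρ : Measure 𝒴) [IsProbabilityMeasure ρ] : IsProbabilityMeasure (proposal ρ) := by
  have := isProbabilityMeasure_volume_Ioc
  rw [proposal]; infer_instance

theorem measurableSet_acceptSet (hr : Measurable r) (n : ℕ) :
    MeasurableSet (acceptSet ρ r n) :=
  measurableSet_lt (by fun_prop) (by fun_prop)

theorem excess_mul_proposal_add [SFinite ρ] (hr : Measurable r) (n : ℕ) {B : Set 𝒴}
    (hB : MeasurableSet B) :
    ENNReal.ofReal (excess ρ r (level ρ r n)) * proposal ρ (acceptSet ρ r n ∩ Prod.fst ⁻¹' B)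
        + ∫⁻ y in B, ENNReal.ofReal (r y - level ρ r (n + 1)) ∂ρ
      = ∫⁻ y in B, ENNReal.ofReal (r y - level ρ r n) ∂ρ := by
  have hs : MeasurableSet (acceptSet ρ r n ∩ Prod.fst ⁻¹' B) :=
    (measurableSet_acceptSet hr n).inter (measurable_fst hB)
  have key : ∀ y, ENNReal.ofReal (excess ρ r (level ρ r n)) *
      (volume.restrict (Ioc (0 : ℝ) 1)) (Prod.mk y ⁻¹' (acceptSet ρ r n ∩ Prod.fst ⁻¹' B))
        + B.indicator (fun y => ENNReal.ofReal (r y - level ρ r (n + 1))) y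
      = B.indicator (fun y => ENNReal.ofReal (r y - level ρ r n)) y := by
    intro y
    by_cases hy : y ∈ B
    · have h := ofReal_mul_volume_add (excess ρ r (level ρ r n)) (r y - level ρ r n)
        (excess_nonneg _ _ _)
      rw [indicator_of_mem hy, indicator_of_mem hy, ← h, level, sub_sub]
      congr 2
      rw [Measure.restrict_apply (measurable_prodMk_left hs), inter_comm]
      congr 1
      ext u
      simp [acceptSet, hy]
    · rw [indicator_of_notMem hy, indicator_of_notMem hy]
      have : Prod.mk y ⁻¹' (acceptSet ρ r n ∩ Prod.fst ⁻¹' B) = (∅ : Set ℝ) := by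
        ext u; simp [hy]
      rw [this]; simp
  rw [proposal, Measure.prod_apply hs, ← lintegral_indicator hB, ← lintegral_indicator hB,
    ← lintegral_const_mul _ (measurable_measure_prodMk_left hs),
    ← lintegral_add_right _ (Measurable.indicator (by fun_prop) hB)]
  exact lintegral_congr key

theorem excess_mul_proposal_add_excess [SFinite ρ] (hr : Measurable r)
    (h1 : ∫⁻ y, ENNReal.ofReal (r y) ∂ρ = 1) (n : ℕ) :
    ENNReal.ofReal (excess ρ r (level ρ r n)) * proposal ρ (acceptSet ρ r n)
        + ENNReal.ofReal (excess ρ r (level ρ r (n + 1)))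
      = ENNReal.ofReal (excess ρ r (level ρ r n)) := by
  have h := excess_mul_proposal_add (ρ := ρ) hr n MeasurableSet.univ
  rw [preimage_univ, inter_univ, Measure.restrict_univ] at h
  rw [ofReal_excess h1 (level_nonneg ρ r (n + 1)), h, ofReal_excess h1 (level_nonneg ρ r n)]

theorem acceptTime_eq {n : ℕ} {B : Set 𝒴} {z : ℕ → 𝒴 × ℝ} (hz : z ∈ acceptEvent ρ r n B) :
    acceptTime ρ r z = n := by
  refine le_antisymm (Nat.sInf_le hz.2.1) (le_csInf ⟨n, hz.2.1⟩ fun m hm => ?_)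
  by_contra hlt
  exact hz.1 m (not_le.1 hlt) hm

theorem measurableSet_acceptEvent (hr : Measurable r) (n : ℕ) {B : Set 𝒴}
    (hB : MeasurableSet B) : MeasurableSet (acceptEvent ρ r n B) := by
  have hm : Measurable fun z : ℕ → 𝒴 × ℝ => (z n).1 := by fun_prop
  have : MeasurableSet {z : ℕ → 𝒴 × ℝ | ∀ j < n, z j ∉ acceptSet ρ r j} := by
    have : {z : ℕ → 𝒴 × ℝ | ∀ j < n, z j ∉ acceptSet ρ r j}
        = ⋂ j, ⋂ (_ : j < n), (fun z : ℕ → 𝒴 × ℝ => z j) ⁻¹' (acceptSet ρ r j)ᶜ := by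
      ext z; simp
    rw [this]
    exact MeasurableSet.iInter fun j => MeasurableSet.iInter fun _ =>
      measurable_pi_apply j (measurableSet_acceptSet hr j).compl
  have hn : Measurable fun z : ℕ → 𝒴 × ℝ => z n := by fun_prop
  exact this.inter (MeasurableSet.inter (hn (measurableSet_acceptSet hr n)) (hm hB))

theorem pairwise_disjoint_acceptEvent (B : Set 𝒴) :
    Pairwise (Function.onFun Disjoint fun n => acceptEvent ρ r n B) := by
  intro i j hij
  refine Set.disjoint_left.2 fun z hi hj => hij ?_
  rw [← acceptTime_eq hi, acceptTime_eq hj]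

variable [IsProbabilityMeasure ρ]

/-- Round `n` is reached with probability `excess ρ r (level ρ r n)`. -/
theorem prod_proposal_compl (hr : Measurable r) (h1 : ∫⁻ y, ENNReal.ofReal (r y) ∂ρ = 1) (n : ℕ) :
    ∏ j ∈ Finset.range n, proposal ρ (acceptSet ρ r j)ᶜ
      = ENNReal.ofReal (excess ρ r (level ρ r n)) := by
  induction n with
  | zero => simp [level, excess_zero h1]
  | succ n ih =>
    rw [Finset.prod_range_succ, ih]
    have h := excess_mul_proposal_add_excess (ρ := ρ) hr h1 n
    have hne : ENNReal.ofReal (excess ρ r (level ρ r n)) * proposal ρ (acceptSet ρ r n) ≠ ∞ :=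
      ENNReal.mul_ne_top ENNReal.ofReal_ne_top (measure_ne_top _ _)
    refine (ENNReal.add_right_inj hne).1 ?_
    rw [h, ← mul_add, measure_add_measure_compl (measurableSet_acceptSet hr n), measure_univ,
      mul_one]

theorem infinitePi_acceptEvent (hr : Measurable r) (h1 : ∫⁻ y, ENNReal.ofReal (r y) ∂ρ = 1)
    (n : ℕ) {B : Set 𝒴} (hB : MeasurableSet B) :
    Measure.infinitePi (fun _ : ℕ => proposal ρ) (acceptEvent ρ r n B)
      = ENNReal.ofReal (excess ρ r (level ρ r n)) *
        proposal ρ (acceptSet ρ r n ∩ Prod.fst ⁻¹' B) := by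
  classical
  have hset : acceptEvent ρ r n B = Set.pi (Finset.range (n + 1))
      (fun j => if j < n then (acceptSet ρ r j)ᶜ else acceptSet ρ r j ∩ Prod.fst ⁻¹' B) := by
    ext z
    simp only [acceptEvent, mem_ofPred_eq, Set.mem_pi, Finset.coe_range, mem_Iio]
    constructor
    · rintro ⟨h, h'⟩ j hj
      split_ifs with hjn
      · exact h j hjn
      · obtain rfl : j = n := by omega
        exact h'
    · intro h
      refine ⟨fun j hj => ?_, ?_⟩
      · have := h j (by omega)
        rwa [if_pos hj] at this
      · have := h n (by omega)
        rwa [if_neg (lt_irrefl n)] at this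
  rw [hset, Measure.infinitePi_pi, Finset.prod_range_succ, if_neg (lt_irrefl n),
    ← prod_proposal_compl hr h1 n]
  · congr 1
    refine Finset.prod_congr rfl fun j hj => ?_
    rw [if_pos (Finset.mem_range.1 hj)]
  · intro j _
    split_ifs
    · exact (measurableSet_acceptSet hr j).compl
    · exact (measurableSet_acceptSet hr j).inter (measurable_fst hB)

theorem tsum_infinitePi_acceptEvent (hr : Measurable r) (h1 : ∫⁻ y, ENNReal.ofReal (r y) ∂ρ = 1)
    {B : Set 𝒴} (hB : MeasurableSet B) :
    ∑' n, Measure.infinitePi (fun _ : ℕ => proposal ρ) (acceptEvent ρ r n B)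
      = ∫⁻ y in B, ENNReal.ofReal (r y) ∂ρ := by
  set R : ℕ → ℝ≥0∞ := fun n => ∫⁻ y in B, ENNReal.ofReal (r y - level ρ r n) ∂ρ with hR
  have hsum : ∀ N, ∑ n ∈ Finset.range N, Measure.infinitePi (fun _ : ℕ => proposal ρ)
      (acceptEvent ρ r n B) + R N = ∫⁻ y in B, ENNReal.ofReal (r y) ∂ρ := by
    intro N
    induction N with
    | zero => simp [hR, level]
    | succ N ih =>
      rw [Finset.sum_range_succ, infinitePi_acceptEvent hr h1 N hB, add_assoc,
        excess_mul_proposal_add hr N hB]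
      exact ih
  have hR0 : Tendsto R atTop (𝓝 0) := by
    have h : Tendsto (fun n => ENNReal.ofReal (excess ρ r (level ρ r n))) atTop (𝓝 0) := by
      simpa using ENNReal.tendsto_ofReal (tendsto_excess_level hr h1)
    refine tendsto_of_tendsto_of_tendsto_of_le_of_le tendsto_const_nhds h (fun _ => zero_le)
      fun n => ?_
    change R n ≤ ENNReal.ofReal (excess ρ r (level ρ r n))
    rw [ofReal_excess h1 (level_nonneg ρ r n)]
    exact setLIntegral_le_lintegral _ _
  have hlim := (ENNReal.tendsto_nat_tsum (fun n => Measure.infinitePi (fun _ : ℕ => proposal ρ)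
    (acceptEvent ρ r n B))).add hR0
  rw [add_zero] at hlim
  refine tendsto_nhds_unique hlim ?_
  simp_rw [hsum]
  exact tendsto_const_nhds

/-- Almost surely some proposal is accepted. -/
theorem ae_mem_iUnion_acceptEvent (hr : Measurable r) (h1 : ∫⁻ y, ENNReal.ofReal (r y) ∂ρ = 1) :
    ∀ᵐ z ∂(Measure.infinitePi fun _ : ℕ => proposal ρ), z ∈ ⋃ n, acceptEvent ρ r n univ := by
  have hm : MeasurableSet (⋃ n, acceptEvent ρ r n univ) :=
    MeasurableSet.iUnion fun n => measurableSet_acceptEvent hr n MeasurableSet.univ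
  refine (prob_compl_eq_zero_iff hm).2 ?_
  rw [measure_iUnion (pairwise_disjoint_acceptEvent univ)
    (fun n => measurableSet_acceptEvent hr n MeasurableSet.univ),
    tsum_infinitePi_acceptEvent hr h1 MeasurableSet.univ, Measure.restrict_univ, h1]

theorem infinitePi_accepted (hr : Measurable r) (h1 : ∫⁻ y, ENNReal.ofReal (r y) ∂ρ = 1)
    {B : Set 𝒴} (hB : MeasurableSet B) :
    Measure.infinitePi (fun _ : ℕ => proposal ρ) {z | (z (acceptTime ρ r z)).1 ∈ B}
      = ∫⁻ y in B, ENNReal.ofReal (r y) ∂ρ := by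
  rw [← tsum_infinitePi_acceptEvent hr h1 hB, ← measure_iUnion (pairwise_disjoint_acceptEvent B)
    (fun n => measurableSet_acceptEvent hr n hB)]
  refine measure_congr ?_
  filter_upwards [ae_mem_iUnion_acceptEvent hr h1] with z hz
  obtain ⟨n, hn⟩ := mem_iUnion.1 hz
  refine propext ⟨fun h => ?_, fun h => ?_⟩
  · change (z (acceptTime ρ r z)).1 ∈ B at h
    rw [acceptTime_eq hn] at h
    exact mem_iUnion.2 ⟨n, hn.1, hn.2.1, h⟩
  · obtain ⟨m, hm⟩ := mem_iUnion.1 h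
    change (z (acceptTime ρ r z)).1 ∈ B
    rw [acceptTime_eq hm]
    exact hm.2.2

theorem lintegral_acceptTime (hr : Measurable r) (h1 : ∫⁻ y, ENNReal.ofReal (r y) ∂ρ = 1)
    (ψ : ℕ → ℝ≥0∞) :
    ∫⁻ z, ψ (acceptTime ρ r z) ∂(Measure.infinitePi fun _ : ℕ => proposal ρ)
      = ∑' n, ψ n *
        ENNReal.ofReal (excess ρ r (level ρ r n) - excess ρ r (level ρ r (n + 1))) := by
  have hm := fun n => measurableSet_acceptEvent (ρ := ρ) hr n MeasurableSet.univ
  rw [← setLIntegral_univ, ← setLIntegral_congr (s := ⋃ n, acceptEvent ρ r n univ)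
    (eventuallyEq_univ.2 (ae_mem_iUnion_acceptEvent hr h1)),
    lintegral_iUnion hm (pairwise_disjoint_acceptEvent univ)]
  refine tsum_congr fun n => ?_
  rw [setLIntegral_congr_fun (g := fun _ => ψ n) (hm n) (fun z hz => by
    simp only [acceptTime_eq hz]), setLIntegral_const,
    infinitePi_acceptEvent hr h1 n MeasurableSet.univ, preimage_univ, inter_univ]
  congr 1
  refine (ENNReal.add_left_inj (ENNReal.ofReal_ne_top
    (r := excess ρ r (level ρ r (n + 1))))).1 ?_
  rw [excess_mul_proposal_add_excess hr h1, ← ENNReal.ofReal_add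
    (sub_nonneg.2 (excess_anti h1 (level_nonneg ρ r n) (level_mono ρ r n.le_succ)))
    (excess_nonneg _ _ _), sub_add_cancel]

section Measurability

variable {𝒳 : Type*} [MeasurableSpace 𝒳] {f : 𝒳 × 𝒴 → ℝ}

theorem measurable_level (hf : Measurable f) (n : ℕ) :
    Measurable fun x => level ρ (fun y => f (x, y)) n := by
  have he : Measurable fun p : 𝒳 × ℝ => excess ρ (fun y => f (p.1, y)) p.2 := by
    refine Measurable.ennreal_toReal ?_
    exact Measurable.lintegral_prod_right'
      (f := fun q : (𝒳 × ℝ) × 𝒴 => ENNReal.ofReal (f (q.1.1, q.2) - q.1.2)) (by fun_prop)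
  induction n with
  | zero => exact measurable_const
  | succ n ih => exact ih.add (he.comp (measurable_id.prodMk ih))

theorem measurable_acceptTime (hf : Measurable f) :
    Measurable fun p : 𝒳 × (ℕ → 𝒴 × ℝ) => acceptTime ρ (fun y => f (p.1, y)) p.2 := by
  have hl := measurable_level (ρ := ρ) hf
  have hstep : ∀ n, Measurable fun x =>
      excess ρ (fun y => f (x, y)) (level ρ (fun y => f (x, y)) n) := by
    intro n
    have : (fun x => excess ρ (fun y => f (x, y)) (level ρ (fun y => f (x, y)) n))
        = fun x => level ρ (fun y => f (x, y)) (n + 1) - level ρ (fun y => f (x, y)) n := by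
      ext x; rw [level]; ring
    rw [this]
    exact (hl (n + 1)).sub (hl n)
  have hA : ∀ n, MeasurableSet {p : 𝒳 × (ℕ → 𝒴 × ℝ) |
      p.2 n ∈ acceptSet ρ (fun y => f (p.1, y)) n} := by
    intro n
    have hfst : Measurable (Prod.fst : 𝒳 × (ℕ → 𝒴 × ℝ) → 𝒳) := measurable_fst
    have hs := (hstep n).comp hfst
    have hl := (hl n).comp hfst
    exact measurableSet_lt (f := fun p : 𝒳 × (ℕ → 𝒴 × ℝ) => (p.2 n).2 *
        excess ρ (fun y => f (p.1, y)) (level ρ (fun y => f (p.1, y)) n))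
      (g := fun p => f (p.1, (p.2 n).1) - level ρ (fun y => f (p.1, y)) n)
      (Measurable.mul (by fun_prop) hs) (Measurable.sub (by fun_prop) hl)
  -- `sInf` is the first success, or `0` if there is none.
  classical
  have hex : ∀ p : 𝒳 × (ℕ → 𝒴 × ℝ), ∃ n, p.2 n ∈ acceptSet ρ (fun y => f (p.1, y)) n ∨
      ∀ m, p.2 m ∉ acceptSet ρ (fun y => f (p.1, y)) m := by
    intro p
    by_cases h : ∃ n, p.2 n ∈ acceptSet ρ (fun y => f (p.1, y)) n
    · exact h.imp fun n hn => Or.inl hn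
    · exact ⟨0, Or.inr (not_exists.1 h)⟩
  have heq : (fun p : 𝒳 × (ℕ → 𝒴 × ℝ) => acceptTime ρ (fun y => f (p.1, y)) p.2)
      = fun p => Nat.find (hex p) := by
    ext p
    by_cases h : ∃ n, p.2 n ∈ acceptSet ρ (fun y => f (p.1, y)) n
    · refine le_antisymm (Nat.sInf_le ?_) (Nat.find_min' _ (Or.inl (Nat.sInf_mem h)))
      exact (Nat.find_spec (hex p)).resolve_right fun h' => h.elim fun m hm => h' m hm
    · have h' := not_exists.1 h
      have : {n | p.2 n ∈ acceptSet ρ (fun y => f (p.1, y)) n} = ∅ := by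
        ext n; simpa using h' n
      rw [acceptTime, this, Nat.sInf_empty]
      exact ((Nat.find_eq_zero _).2 (Or.inr h')).symm
  rw [heq]
  refine measurable_find hex fun n => ?_
  refine (hA n).union ?_
  have : {p : 𝒳 × (ℕ → 𝒴 × ℝ) | ∀ m, p.2 m ∉ acceptSet ρ (fun y => f (p.1, y)) m}
      = ⋂ m, {p : 𝒳 × (ℕ → 𝒴 × ℝ) | p.2 m ∈ acceptSet ρ (fun y => f (p.1, y)) m}ᶜ := by
    ext p; simp
  change MeasurableSet {p : 𝒳 × (ℕ → 𝒴 × ℝ) | ∀ m, p.2 m ∉ acceptSet ρ (fun y => f (p.1, y)) m}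
  rw [this]
  exact MeasurableSet.iInter fun m => (hA m).compl

theorem measurable_accepted (hf : Measurable f) :
    Measurable fun p : 𝒳 × (ℕ → 𝒴 × ℝ) =>
      (p.2 (acceptTime ρ (fun y => f (p.1, y)) p.2)).1 := by
  have h : Measurable fun q : (ℕ → 𝒴 × ℝ) × ℕ => (q.1 q.2).1 :=
    measurable_from_prod_countable_left fun n => by fun_prop
  exact h.comp (measurable_snd.prodMk (measurable_acceptTime hf))

end Measurability

end Sampling

/-! ### Entropy and cross entropy -/

section CrossEntropy

/-- **Gibbs' inequality**: the entropy of an image of a law on `ℕ` is at most the cross entropy of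
that law with respect to any sub-probability weights `q`. -/
theorem shannonEntropy_map_le {𝒴 : Type*} [MeasurableSpace 𝒴] [StandardBorelSpace 𝒴]
    (p : Measure ℕ) [IsProbabilityMeasure p] (y : ℕ → 𝒴) {q : ℕ → ℝ} (hq0 : ∀ n, 0 < q n)
    (hq1 : ∀ n, q n ≤ 1) (hq : ∑' n, ENNReal.ofReal (q n) ≤ 1) :
    shannonEntropy (p.map y) ≤ ∫⁻ n, ENNReal.ofReal (-Real.logb 2 (q n)) ∂p := by
  have hym : Measurable y := measurable_of_countable y
  have : IsProbabilityMeasure (p.map y) := Measure.isProbabilityMeasure_map hym.aemeasurable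
  have hlog : 0 < Real.log 2 := Real.log_pos one_lt_two
  set ν := p.map y with hν
  have hsing : Measurable fun b : 𝒴 => ν {b} :=
    (Kernel.measurable_singleton_apply (Kernel.const Unit ν)).comp
      ((measurable_const (a := ())).prodMk measurable_id)
  classical
  set E : 𝒴 → ℝ≥0∞ := fun b => if ν {b} = 0 then ∞ else ENNReal.ofReal (-Real.logb 2 (ν {b}).toReal)
    with hE
  have hEm : Measurable E := by
    refine Measurable.ite (hsing (measurableSet_singleton 0)) measurable_const ?_
    exact ENNReal.measurable_ofReal.comp
      ((Real.measurable_log.comp hsing.ennreal_toReal).div_const _).neg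
  have hle : ∀ n, p {n} ≤ ν {y n} := by
    intro n
    rw [hν, Measure.map_apply hym (measurableSet_singleton _)]
    exact measure_mono (by simp)
  -- `p log (q / ν) ≤ p q / ν - p ≤ q - p`, rearranged so that all terms are nonnegative
  have hpt : ∀ n, ENNReal.ofReal (Real.log 2) * (E (y n) * p {n}) + p {n} ≤
      ENNReal.ofReal (Real.log 2) * (ENNReal.ofReal (-Real.logb 2 (q n)) * p {n})
        + ENNReal.ofReal (q n) := by
    intro n
    by_cases hp : p {n} = 0
    · simp [hp]
    have hν0 : ν {y n} ≠ 0 := fun h => hp (le_antisymm (h ▸ hle n) zero_le)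
    have hpr : 0 < (p {n}).toReal := ENNReal.toReal_pos hp (measure_ne_top _ _)
    have hνr : 0 < (ν {y n}).toReal := ENNReal.toReal_pos hν0 (measure_ne_top _ _)
    have hpν : (p {n}).toReal ≤ (ν {y n}).toReal :=
      (ENNReal.toReal_le_toReal (measure_ne_top _ _) (measure_ne_top _ _)).2 (hle n)
    have hν1 : (ν {y n}).toReal ≤ 1 := measureReal_le_one
    simp only [hE, hν0, if_false]
    rw [← ENNReal.ofReal_toReal (measure_ne_top p {n})]
    set a := (p {n}).toReal
    set b := (ν {y n}).toReal
    have hb : 0 ≤ -Real.logb 2 b := by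
      rw [Real.logb, ← neg_div]
      exact div_nonneg (neg_nonneg.2 (Real.log_nonpos hνr.le hν1)) hlog.le
    have hqn : 0 ≤ -Real.logb 2 (q n) := by
      rw [Real.logb, ← neg_div]
      exact div_nonneg (neg_nonneg.2 (Real.log_nonpos (hq0 n).le (hq1 n))) hlog.le
    rw [← ENNReal.ofReal_mul hb, ← ENNReal.ofReal_mul hqn, ← ENNReal.ofReal_mul hlog.le,
      ← ENNReal.ofReal_mul hlog.le, ← ENNReal.ofReal_add (by positivity) (by positivity),
      ← ENNReal.ofReal_add (by positivity) (hq0 n).le]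
    refine ENNReal.ofReal_le_ofReal ?_
    have e1 : Real.log 2 * (-Real.logb 2 b * a) = -Real.log b * a := by
      rw [Real.logb]; field_simp
    have e2 : Real.log 2 * (-Real.logb 2 (q n) * a) = -Real.log (q n) * a := by
      rw [Real.logb]; field_simp
    rw [e1, e2]
    have h1 := Real.log_le_sub_one_of_pos (div_pos (hq0 n) hνr)
    rw [Real.log_div (hq0 n).ne' hνr.ne'] at h1
    have h2 : a * (q n / b) ≤ q n := by
      rw [mul_div_assoc', div_le_iff₀ hνr, mul_comm]
      exact mul_le_mul_of_nonneg_left hpν (hq0 n).le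
    nlinarith [mul_le_mul_of_nonneg_left h1 hpr.le]
  have hsum : ∑' n, p {n} = 1 := by
    have := lintegral_countable' (μ := p) (fun _ => 1)
    simpa using this.symm
  have htot := ENNReal.tsum_le_tsum hpt
  rw [ENNReal.tsum_add, ENNReal.tsum_add, ENNReal.tsum_mul_left, ENNReal.tsum_mul_left,
    hsum] at htot
  have h2 := htot.trans (add_le_add_right hq _)
  rw [ENNReal.add_le_add_iff_right ENNReal.one_ne_top,
    ENNReal.mul_le_mul_iff_right (by simpa using hlog) ENNReal.ofReal_ne_top] at h2
  have hH : shannonEntropy ν = ∫⁻ b, E b ∂ν := by simp only [shannonEntropy, hE]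
  rw [hH, hν, lintegral_map hEm hym, lintegral_countable', lintegral_countable']
  exact h2

/-- Weights on `ℕ` proportional to `(n + 1) ^ (-(1 + s))`. -/
def powerWeight (s : ℝ) (n : ℕ) : ℝ := s / (1 + s) * ((n : ℝ) + 1) ^ (-(1 + s))

theorem powerWeight_pos {s : ℝ} (hs : 0 < s) (n : ℕ) : 0 < powerWeight s n := by
  unfold powerWeight; positivity

theorem sum_rpow_le {s : ℝ} (hs : 0 < s) (N : ℕ) :
    ∑ n ∈ Finset.range (N + 1), ((n : ℝ) + 1) ^ (-(1 + s))
      ≤ 1 + 1 / s * (1 - ((N : ℝ) + 1) ^ (-s)) := by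
  induction N with
  | zero => simp
  | succ N ih =>
    rw [Finset.sum_range_succ]
    push_cast
    have ha : (0 : ℝ) < (N : ℝ) + 1 := by positivity
    have hb : (0 : ℝ) < (N : ℝ) + 1 + 1 := by positivity
    set a : ℝ := (N : ℝ) + 1
    have key : s * (a + 1) ^ (-(1 + s)) ≤ a ^ (-s) - (a + 1) ^ (-s) := by
      -- `(a / (a + 1)) ^ (-s) ≥ 1 - s log (a / (a + 1)) ≥ 1 + s / (a + 1)`
      have h1 : 1 + s / (a + 1) ≤ (a / (a + 1)) ^ (-s) := by
        rw [Real.rpow_def_of_pos (div_pos ha hb)]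
        have h2 := Real.log_le_sub_one_of_pos (div_pos ha hb)
        have h3 := Real.add_one_le_exp (Real.log (a / (a + 1)) * -s)
        have h4 : a / (a + 1) - 1 = -(1 / (a + 1)) := by field_simp; ring
        rw [h4] at h2
        have h5 : s / (a + 1) = s * (1 / (a + 1)) := by ring
        rw [h5]
        nlinarith [mul_le_mul_of_nonneg_left h2 hs.le]
      have h2 : (a / (a + 1)) ^ (-s) = a ^ (-s) / (a + 1) ^ (-s) :=
        Real.div_rpow ha.le hb.le _
      have hpos : 0 < (a + 1) ^ (-s) := Real.rpow_pos_of_pos hb _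
      rw [h2, le_div_iff₀ hpos] at h1
      have h3 : (a + 1) ^ (-(1 + s)) = (a + 1) ^ (-s) / (a + 1) := by
        rw [show -(1 + s) = -s - 1 by ring, Real.rpow_sub_one hb.ne']
      rw [h3]
      have h4 : s * ((a + 1) ^ (-s) / (a + 1)) = s / (a + 1) * (a + 1) ^ (-s) := by ring
      rw [h4]
      linarith
    have h6 : (a + 1) ^ (-(1 + s)) ≤ 1 / s * (a ^ (-s) - (a + 1) ^ (-s)) := by
      rw [one_div, ← div_eq_inv_mul, le_div_iff₀ hs]
      linarith
    calc _ ≤ 1 + 1 / s * (1 - a ^ (-s)) + 1 / s * (a ^ (-s) - (a + 1) ^ (-s)) := add_le_add ih h6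
      _ = _ := by ring

theorem tsum_powerWeight_le {s : ℝ} (hs : 0 < s) :
    ∑' n, ENNReal.ofReal (powerWeight s n) ≤ 1 := by
  refine ENNReal.tsum_le_of_sum_range_le fun N => ?_
  have hN : ∑ n ∈ Finset.range N, powerWeight s n ≤ 1 := by
    have h1 : ∑ n ∈ Finset.range N, powerWeight s n ≤ ∑ n ∈ Finset.range (N + 1), powerWeight s n :=
      Finset.sum_le_sum_of_subset_of_nonneg (by simp) fun n _ _ => (powerWeight_pos hs n).le
    refine h1.trans ?_
    unfold powerWeight
    rw [← Finset.mul_sum]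
    have h2 : ∑ n ∈ Finset.range (N + 1), ((n : ℝ) + 1) ^ (-(1 + s)) ≤ 1 + 1 / s := by
      refine (sum_rpow_le hs N).trans ?_
      have : 0 ≤ 1 / s * ((N : ℝ) + 1) ^ (-s) := by positivity
      linarith
    calc s / (1 + s) * _ ≤ s / (1 + s) * (1 + 1 / s) :=
          mul_le_mul_of_nonneg_left h2 (by positivity)
      _ = 1 := by rw [one_add_div hs.ne', add_comm s 1]; field_simp
  rw [← ENNReal.ofReal_sum_of_nonneg fun n _ => (powerWeight_pos hs n).le]
  exact ENNReal.ofReal_le_one.2 hN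

theorem powerWeight_le_one {s : ℝ} (hs : 0 < s) (n : ℕ) : powerWeight s n ≤ 1 :=
  ENNReal.ofReal_le_one.1 ((ENNReal.le_tsum n).trans (tsum_powerWeight_le hs))

theorem neg_logb_powerWeight {s : ℝ} (hs : 0 < s) (n : ℕ) :
    -Real.logb 2 (powerWeight s n)
      = (1 + s) / Real.log 2 * Real.log (n + 1) + Real.logb 2 (1 + 1 / s) := by
  have hn : (0 : ℝ) < (n : ℝ) + 1 := by positivity
  have h1 : Real.log (s / (1 + s)) = -Real.log (1 + 1 / s) := by
    rw [← Real.log_inv, one_add_div hs.ne', inv_div, add_comm s 1]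
  rw [powerWeight, Real.logb, Real.logb, Real.log_mul (by positivity)
    (Real.rpow_pos_of_pos hn _).ne', Real.log_rpow hn, h1]
  ring

/-- The numerical estimate behind the constant `4`: `E = I + log₂ e` bounds the mean of the
logarithm of the number of rounds, and `s = 1 / E` is the exponent of the weights. -/
theorem log_bound_le {I : ℝ} (hI : 0 ≤ I) :
    (I + 1 / Real.log 2) + 1 + Real.logb 2 (1 + (I + 1 / Real.log 2))
      ≤ I + (Real.logb 2 (I + 1) + 4) := by
  have hlog : 0 < Real.log 2 := Real.log_pos one_lt_two
  have he : 1 / Real.log 2 ≤ 1.45 := by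
    rw [div_le_iff₀ hlog]; linarith [Real.log_two_gt_d9]
  have h1 : Real.logb 2 (1 + (I + 1 / Real.log 2)) ≤ Real.logb 2 (I + 1) + Real.logb 2 2.45 := by
    rw [← Real.logb_mul (by positivity) (by norm_num)]
    exact Real.logb_le_logb_of_le one_lt_two (by positivity) (by nlinarith)
  have h2 : Real.logb 2 2.45 ≤ 1.5 := by
    rw [Real.logb_le_iff_le_rpow one_lt_two (by norm_num)]
    have : (2 : ℝ) ^ (1.5 : ℝ) = 2 * Real.sqrt 2 := by
      rw [show (1.5 : ℝ) = 1 + 1 / 2 by norm_num, Real.rpow_add two_pos, Real.rpow_one,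
        Real.sqrt_eq_rpow]
    rw [this]
    have : (1.4 : ℝ) ≤ Real.sqrt 2 := Real.le_sqrt_of_sq_le (by norm_num)
    linarith
  linarith

end CrossEntropy

/-! ### The functional representation -/

section Representation

open Filter Set

variable {𝒳 : Type*} {𝒴 : Type*} [MeasurableSpace 𝒳] [MeasurableSpace 𝒴]

/-- A jointly measurable density of a law `J` of finite mutual information with respect to the
product of its marginals, normalized on almost every fibre. -/
theorem exists_density (J : Measure (𝒳 × 𝒴)) [IsProbabilityMeasure J]
    (hI : klDiv J (J.fst.prod J.snd) ≠ ∞) :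
    ∃ f : 𝒳 × 𝒴 → ℝ, Measurable f ∧ (∀ p, 0 ≤ f p) ∧
      (J.fst.prod J.snd).withDensity (fun p => ENNReal.ofReal (f p)) = J ∧
      (∀ᵐ x ∂J.fst, ∫⁻ y, ENNReal.ofReal (f (x, y)) ∂J.snd = 1) ∧
      Integrable (fun p => f p * Real.log (f p)) (J.fst.prod J.snd) ∧
      ∫ p, f p * Real.log (f p) ∂(J.fst.prod J.snd) = (klDiv J (J.fst.prod J.snd)).toReal := by
  obtain ⟨hac, hint⟩ := klDiv_ne_top_iff.1 hI
  set B := J.fst.prod J.snd with hB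
  set f : 𝒳 × 𝒴 → ℝ := fun p => (J.rnDeriv B p).toReal with hf
  have hfm : Measurable f := (Measure.measurable_rnDeriv J B).ennreal_toReal
  have hJ : B.withDensity (fun p => ENNReal.ofReal (f p)) = J := by
    conv_rhs => rw [← Measure.withDensity_rnDeriv_eq J B hac]
    refine withDensity_congr_ae ?_
    filter_upwards [Measure.rnDeriv_lt_top J B] with p hp
    exact ENNReal.ofReal_toReal hp.ne
  refine ⟨f, hfm, fun p => ENNReal.toReal_nonneg, hJ, ?_,
    (integrable_rnDeriv_mul_log_iff hac).2 hint, ?_⟩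
  · refine ae_eq_of_forall_setLIntegral_eq_of_sigmaFinite
      (Measurable.lintegral_prod_right' (f := fun p => ENNReal.ofReal (f p)) (by fun_prop))
      measurable_const fun s hs _ => ?_
    have h : J.fst s = ∫⁻ x in s, ∫⁻ y, ENNReal.ofReal (f (x, y)) ∂J.snd ∂J.fst := by
      conv_lhs => rw [Measure.fst_apply hs, ← hJ, withDensity_apply _ (measurable_fst hs), hB,
        ← prod_univ, ← Measure.prod_restrict, Measure.restrict_univ]
      exact lintegral_prod _ (by fun_prop)
    rw [← h]; simp
  · rw [toReal_klDiv_of_measure_eq hac (by simp), ← integral_rnDeriv_mul_log hac]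

/-- The functional representation by greedy rejection sampling: `Z` is the sequence of proposals,
and `g (x, Z)` is the first proposal accepted for the density `f (x, ·)`. -/
theorem exists_functional_representation [StandardBorelSpace 𝒴] (J : Measure (𝒳 × 𝒴))
    [IsProbabilityMeasure J] (hI : klDiv J (J.fst.prod J.snd) ≠ ∞) {I : ℝ}
    (hIdef : I = (klDiv J (J.fst.prod J.snd)).toReal / Real.log 2) :
    ∃ (μ : Measure (ℕ → 𝒴 × ℝ)) (g : 𝒳 × (ℕ → 𝒴 × ℝ) → 𝒴), IsProbabilityMeasure μ ∧ Measurable g ∧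
      (J.fst.prod μ).map (fun p => (p.1, g p)) = J ∧
      ∫⁻ z, shannonEntropy (fiberKernel J.fst g z) ∂μ
        ≤ ENNReal.ofReal (I + (Real.logb 2 (I + 1) + 4)) := by
  obtain ⟨f, hfm, hf0, hJ, hf1, hint, hval⟩ := exists_density J hI
  have hlog : 0 < Real.log 2 := Real.log_pos one_lt_two
  have hI0 : 0 ≤ I := by rw [hIdef]; positivity
  set σ := J.fst
  set ρ := J.snd
  set μ := Measure.infinitePi fun _ : ℕ => proposal ρ with hμ
  set K : 𝒳 × (ℕ → 𝒴 × ℝ) → ℕ := fun p => acceptTime ρ (fun y => f (p.1, y)) p.2 with hK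
  have hKm : Measurable K := measurable_acceptTime hfm
  set g : 𝒳 × (ℕ → 𝒴 × ℝ) → 𝒴 := fun p => (p.2 (K p)).1 with hg
  have hgm : Measurable g := measurable_accepted hfm
  have hfx : ∀ x, Measurable fun y => f (x, y) := fun x => by fun_prop
  refine ⟨μ, g, inferInstance, hgm, ?_, ?_⟩
  · ext s hs
    have hm : Measurable fun p : 𝒳 × (ℕ → 𝒴 × ℝ) => (p.1, g p) := by fun_prop
    rw [Measure.map_apply hm hs, Measure.prod_apply (hm hs)]
    conv_rhs => rw [← hJ, withDensity_apply _ hs, ← lintegral_indicator hs,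
      lintegral_prod _ (Measurable.indicator (by fun_prop) hs).aemeasurable]
    refine lintegral_congr_ae ?_
    filter_upwards [hf1] with x hx
    have h := infinitePi_accepted (hfx x) hx (measurable_prodMk_left (x := x) hs)
    rw [← lintegral_indicator (measurable_prodMk_left hs)] at h
    exact h
  set E := I + 1 / Real.log 2 with hE
  have hE0 : 0 < E := by positivity
  set s := 1 / E with hs
  have hs0 : 0 < s := by positivity
  have hψ : ∀ n : ℕ, ENNReal.ofReal (-Real.logb 2 (powerWeight s n)) =
      ENNReal.ofReal ((1 + s) / Real.log 2) * ENNReal.ofReal (Real.log (n + 1))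
        + ENNReal.ofReal (Real.logb 2 (1 + E)) := by
    intro n
    have h1 : 0 ≤ Real.log ((n : ℝ) + 1) := Real.log_nonneg (by simp)
    have h2 : 0 ≤ Real.logb 2 (1 + E) := Real.logb_nonneg one_lt_two (by linarith)
    rw [neg_logb_powerWeight hs0, hs, one_div_one_div, ← ENNReal.ofReal_mul (by positivity),
      ← ENNReal.ofReal_add (by positivity) h2]
  have hψm : Measurable fun p => ENNReal.ofReal (-Real.logb 2 (powerWeight s (K p))) :=
    (measurable_of_countable fun n : ℕ => ENNReal.ofReal (-Real.logb 2 (powerWeight s n))).comp hKm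
  have hstep1 : ∀ z, shannonEntropy (fiberKernel σ g z)
      ≤ ∫⁻ x, ENNReal.ofReal (-Real.logb 2 (powerWeight s (K (x, z)))) ∂σ := by
    intro z
    have hKz : Measurable fun x => K (x, z) := by fun_prop
    have : IsProbabilityMeasure (σ.map fun x => K (x, z)) :=
      Measure.isProbabilityMeasure_map hKz.aemeasurable
    have h := shannonEntropy_map_le (σ.map fun x => K (x, z)) (fun n => (z n).1)
      (powerWeight_pos hs0) (powerWeight_le_one hs0) (tsum_powerWeight_le hs0)
    rw [Measure.map_map (measurable_of_countable _) hKz,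
      lintegral_map (measurable_of_countable _) hKz] at h
    rw [fiberKernel_apply σ hgm]
    exact h
  have hstep2 : ∀ᵐ x ∂σ, ∫⁻ z, ENNReal.ofReal (-Real.logb 2 (powerWeight s (K (x, z)))) ∂μ
      ≤ ENNReal.ofReal ((1 + s) / Real.log 2) *
          ENNReal.ofReal (∫ y, f (x, y) * Real.log (f (x, y)) ∂ρ + 1)
        + ENNReal.ofReal (Real.logb 2 (1 + E)) := by
    filter_upwards [hf1, hint.prod_right_ae] with x hx hix
    simp_rw [hψ]
    rw [lintegral_add_right _ measurable_const, lintegral_const_mul' _ _ ENNReal.ofReal_ne_top,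
      lintegral_const, measure_univ, mul_one]
    gcongr
    refine le_of_eq_of_le ?_ (tsum_log_mul_le (hfx x) (fun y => hf0 _) hx hix)
    exact lintegral_acceptTime (hfx x) hx fun n => ENNReal.ofReal (Real.log (n + 1))
  have hD : ∫⁻ x, ENNReal.ofReal (∫ y, f (x, y) * Real.log (f (x, y)) ∂ρ + 1) ∂σ
      = ENNReal.ofReal ((klDiv J (σ.prod ρ)).toReal + 1) := by
    have hi : Integrable (fun x => ∫ y, f (x, y) * Real.log (f (x, y)) ∂ρ) σ :=
      hint.integral_prod_left
    rw [← ofReal_integral_eq_lintegral_ofReal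
      (f := fun x => ∫ y, f (x, y) * Real.log (f (x, y)) ∂ρ + 1) (hi.add (integrable_const 1))]
    · rw [integral_add hi (integrable_const 1), ← hval, integral_prod _ hint]
      simp
    · filter_upwards [hint.prod_right_ae] with x hix
      have h := integral_mono (μ := ρ) (integrable_const (-1)) hix fun y => by
        have := klFun_nonneg (hf0 (x, y))
        have := hf0 (x, y)
        rw [klFun] at *
        linarith
      simp only [integral_const, probReal_univ, smul_eq_mul, one_mul] at h
      change (0 : ℝ) ≤ _
      linarith
  calc ∫⁻ z, shannonEntropy (fiberKernel σ g z) ∂μ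
      ≤ ∫⁻ z, ∫⁻ x, ENNReal.ofReal (-Real.logb 2 (powerWeight s (K (x, z)))) ∂σ ∂μ :=
        lintegral_mono hstep1
    _ = ∫⁻ x, ∫⁻ z, ENNReal.ofReal (-Real.logb 2 (powerWeight s (K (x, z)))) ∂μ ∂σ :=
        (lintegral_lintegral_swap (f := fun x z =>
          ENNReal.ofReal (-Real.logb 2 (powerWeight s (K (x, z))))) hψm.aemeasurable).symm
    _ ≤ ∫⁻ x, (ENNReal.ofReal ((1 + s) / Real.log 2) *
          ENNReal.ofReal (∫ y, f (x, y) * Real.log (f (x, y)) ∂ρ + 1)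
        + ENNReal.ofReal (Real.logb 2 (1 + E))) ∂σ := lintegral_mono_ae hstep2
    _ = ENNReal.ofReal ((1 + s) / Real.log 2) * ENNReal.ofReal ((klDiv J (σ.prod ρ)).toReal + 1)
        + ENNReal.ofReal (Real.logb 2 (1 + E)) := by
        rw [lintegral_add_right _ measurable_const, lintegral_const_mul' _ _ ENNReal.ofReal_ne_top,
          hD, lintegral_const, measure_univ, mul_one]
    _ = ENNReal.ofReal (E + 1 + Real.logb 2 (1 + E)) := by
        rw [← ENNReal.ofReal_mul (by positivity), ← ENNReal.ofReal_add (by positivity)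
          (Real.logb_nonneg one_lt_two (by linarith))]
        congr 2
        have : (klDiv J (σ.prod ρ)).toReal + 1 = Real.log 2 * E := by
          rw [hE, hIdef]; field_simp
        rw [this, hs]; field_simp
    _ ≤ _ := ENNReal.ofReal_le_ofReal (log_bound_le hI0)

end Representation

/-! ### Reduction of the support -/

section FiniteSupport

open Set

theorem measure_eq_add_sum_erase {γ : Type*} {β : Type*} [Fintype β] [DecidableEq β] [Finite γ]
    [MeasurableSpace γ] [MeasurableSingletonClass γ] (m : Measure γ) [IsProbabilityMeasure m]
    (k : γ → β) (b : β) :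
    m {c | k c = b} + ∑ b' ∈ Finset.univ.erase b, m {c | k c = b'} = 1 := by
  have := sum_measure_preimage_singleton (μ := m) (f := k) Finset.univ
    fun b' _ => (Set.toFinite _).measurableSet
  rw [← Finset.add_sum_erase _ _ (Finset.mem_univ b), Finset.coe_univ, preimage_univ,
    measure_univ] at this
  exact this

/-- A random function `A → B` can be replaced by one with at most `|A| (|B| - 1) + 2` values without
changing the law of its value at any point and without increasing the mean of `h`. By
Carathéodory's theorem, since the constraints live in dimension `|A| (|B| - 1) + 1`. -/
theorem exists_finite_support {α : Type*} {β : Type*} [Fintype α] [Fintype β] [DecidableEq α]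
    [DecidableEq β] [Nonempty β] [MeasurableSpace β] [MeasurableSingletonClass β]
    (p : Measure (α → β)) [IsProbabilityMeasure p]
    (h : (α → β) → ℝ≥0∞) (hfin : ∫⁻ f, h f ∂p ≠ ∞) :
    ∃ (n : ℕ) (_ : NeZero n) (ν : Measure (Fin n)) (φ : Fin n → α → β),
      n ≤ Fintype.card α * (Fintype.card β - 1) + 2 ∧ IsProbabilityMeasure ν ∧
      (∀ a b, ν {j | φ j a = b} = p {f | f a = b}) ∧ ∫⁻ j, h (φ j) ∂ν ≤ ∫⁻ f, h f ∂p := by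
  obtain ⟨b₀⟩ := ‹Nonempty β›
  have hp1 : ∑ f, (p {f}).toReal = 1 := by
    rw [← ENNReal.toReal_sum fun f _ => measure_ne_top _ _]
    have := lintegral_fintype (μ := p) (fun _ => 1)
    simp only [lintegral_const, measure_univ, one_mul] at this
    rw [← this, ENNReal.toReal_one]
  rw [lintegral_fintype] at hfin ⊢
  have hh : ∀ f, p {f} ≠ 0 → h f ≠ ∞ := by
    intro f hf hinf
    refine hfin (ENNReal.sum_eq_top.2 ⟨f, Finset.mem_univ f, ?_⟩)
    rw [hinf, ENNReal.top_mul hf]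
  -- the masses `P(f a = b)` for `b ≠ b₀`, and the mean of `h`, are the mean of the vectors `V f`
  set V : (α → β) → (α × {b : β // b ≠ b₀} → ℝ) × ℝ := fun f =>
    (fun q => if f q.1 = q.2 then 1 else 0, (h f).toReal) with hV
  set S : Set (α → β) := {f | p {f} ≠ 0} with hS
  have hmem : ∑ f, (p {f}).toReal • V f ∈ convexHull ℝ (V '' S) := by
    classical
    have hz : ∀ f, f ∉ Finset.univ.filter (fun f => p {f} ≠ 0) → (p {f}).toReal = 0 := by
      intro f hf
      have : p {f} = 0 := by simpa using hf
      rw [this, ENNReal.toReal_zero]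
    rw [← Finset.sum_subset (Finset.subset_univ (Finset.univ.filter fun f => p {f} ≠ 0))
      (fun f _ hf => by rw [hz f hf, zero_smul])]
    refine (convex_convexHull ℝ _).sum_mem (fun _ _ => ENNReal.toReal_nonneg) ?_ fun f hf =>
      subset_convexHull ℝ _ ⟨f, (Finset.mem_filter.1 hf).2, rfl⟩
    rw [← hp1]
    exact Finset.sum_subset (Finset.subset_univ _) fun f _ hf => hz f hf
  obtain ⟨ι, hι, z, w, hzs, hind, hw0, hw1, hwz⟩ := eq_pos_convex_span_of_mem_convexHull hmem
  choose ψ hψS hψ using fun i => hzs (mem_range_self i)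
  have hcard : Fintype.card ι ≤ Fintype.card α * (Fintype.card β - 1) + 2 := by
    refine (hind.card_le_finrank_succ).trans ?_
    have h1 := (vectorSpan ℝ (range z)).finrank_le
    rw [Module.finrank_prod, Module.finrank_fintype_fun_eq_card, Module.finrank_self,
      Fintype.card_prod, Fintype.card_subtype_compl, Fintype.card_subtype_eq] at h1
    omega
  have hne : Nonempty ι := by
    by_contra hemp
    rw [not_nonempty_iff] at hemp
    simp at hw1
  set e := (Fintype.equivFin ι).symm with he
  set φ : Fin (Fintype.card ι) → α → β := fun j => ψ (e j) with hφ
  set ν : Measure (Fin (Fintype.card ι)) :=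
    ∑ j, ENNReal.ofReal (w (e j)) • Measure.dirac j with hν
  have hν_apply : ∀ s : Set (Fin (Fintype.card ι)), ν s
      = ENNReal.ofReal (∑ j, w (e j) * s.indicator 1 j) := by
    intro s
    rw [hν, Measure.finsetSum_apply, ENNReal.ofReal_sum_of_nonneg]
    · refine Finset.sum_congr rfl fun j _ => ?_
      rw [Measure.smul_apply, Measure.dirac_apply' _ (MeasurableSet.of_discrete), smul_eq_mul]
      by_cases hj : j ∈ s <;> simp [hj]
    · exact fun j _ => mul_nonneg (hw0 _).le (indicator_nonneg (fun _ _ => zero_le_one) _)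
  have hsum : ∀ F : ι → ℝ, ∑ j, w (e j) * F (e j) = ∑ i, w i * F i := fun F =>
    Equiv.sum_comp e fun i => w i * F i
  have hνP : IsProbabilityMeasure ν := by
    refine ⟨?_⟩
    rw [hν_apply]
    simp only [indicator_univ, Pi.one_apply]
    rw [hsum fun _ => 1]
    simp [hw1]
  have hp_apply : ∀ s : Set (α → β),
      p s = ENNReal.ofReal (∑ f, (p {f}).toReal * s.indicator 1 f) := by
    intro s
    rw [← lintegral_indicator_one (Set.toFinite s).measurableSet, lintegral_fintype,
      ENNReal.ofReal_sum_of_nonneg]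
    · refine Finset.sum_congr rfl fun f _ => ?_
      by_cases hf : f ∈ s <;> simp [hf]
    · exact fun f _ => mul_nonneg ENNReal.toReal_nonneg
        (indicator_nonneg (fun _ _ => zero_le_one) _)
  have hmarg : ∀ a b, b ≠ b₀ → ν {j | φ j a = b} = p {f | f a = b} := by
    intro a b hb
    rw [hν_apply, hp_apply]
    congr 1
    have h2 := congrFun (congrArg Prod.fst hwz) (a, ⟨b, hb⟩)
    simp only [Prod.fst_sum, Finset.sum_apply, Prod.smul_fst, Pi.smul_apply, smul_eq_mul, ← hψ,
      hV] at h2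
    have h3 := hsum fun i => if ψ i a = b then 1 else 0
    calc _ = ∑ j, w (e j) * (if ψ (e j) a = b then 1 else 0) := by
          refine Finset.sum_congr rfl fun j _ => ?_
          simp [indicator_apply, hφ]
      _ = _ := h3
      _ = _ := h2
      _ = _ := by
          refine Finset.sum_congr rfl fun f _ => ?_
          simp [indicator_apply]
  refine ⟨Fintype.card ι, ⟨Fintype.card_ne_zero⟩, ν, φ, hcard, hνP, fun a b => ?_, ?_⟩
  · by_cases hb : b = b₀
    · -- the mass of `b₀` is determined by the other masses
      subst hb
      have h1 := measure_eq_add_sum_erase ν (fun j => φ j a) b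
      have h2 := measure_eq_add_sum_erase p (fun f => f a) b
      rw [← h2, Finset.sum_congr rfl fun b' hb' => hmarg a b' (Finset.ne_of_mem_erase hb')] at h1
      exact (ENNReal.add_left_inj (ENNReal.sum_ne_top.2 fun _ _ => measure_ne_top _ _)).1 h1
    · exact hmarg a b hb
  · rw [lintegral_fintype]
    have h2 := congrArg Prod.snd hwz
    simp only [Prod.snd_sum, Prod.smul_snd, smul_eq_mul, ← hψ, hV] at h2
    calc ∑ j, h (φ j) * ν {j}
        = ∑ j, ENNReal.ofReal (w (e j) * (h (ψ (e j))).toReal) := by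
          refine Finset.sum_congr rfl fun j _ => ?_
          have hj : ν {j} = ENNReal.ofReal (w (e j)) := by
            rw [hν_apply]; simp [indicator_apply]
          rw [hj, ENNReal.ofReal_mul (hw0 _).le, ENNReal.ofReal_toReal (hh _ (hψS _)), mul_comm]
      _ = ENNReal.ofReal (∑ f, (p {f}).toReal * (h f).toReal) := by
          rw [← ENNReal.ofReal_sum_of_nonneg
            fun j _ => mul_nonneg (hw0 _).le ENNReal.toReal_nonneg,
            hsum fun i => (h (ψ i)).toReal, h2]
      _ = ∑ f, ENNReal.ofReal ((p {f}).toReal * (h f).toReal) :=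
          ENNReal.ofReal_sum_of_nonneg
            fun f _ => mul_nonneg ENNReal.toReal_nonneg ENNReal.toReal_nonneg
      _ ≤ ∑ f, h f * p {f} := by
          refine Finset.sum_le_sum fun f _ => ?_
          rw [ENNReal.ofReal_mul ENNReal.toReal_nonneg, mul_comm]
          exact mul_le_mul' ENNReal.ofReal_toReal_le ENNReal.ofReal_toReal_le

end FiniteSupport

/-! ### Representations on finite sets -/

section FiniteRepresentation

open Set

variable {𝒳 : Type*} {𝒴 : Type*} {𝒵 : Type*} [MeasurableSpace 𝒳] [MeasurableSpace 𝒴]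
  [MeasurableSpace 𝒵]

open Classical in
/-- The extension of a function on a finite set by a constant. -/
def extendConst (A : Finset 𝒳) {B : Finset 𝒴} (b₀ : 𝒴) (f : A → B) (x : 𝒳) : 𝒴 :=
  if hx : x ∈ A then f ⟨x, hx⟩ else b₀

theorem measurable_extendConst [MeasurableSingletonClass 𝒳] (A : Finset 𝒳) {B : Finset 𝒴}
    (b₀ : 𝒴) (f : A → B) : Measurable (extendConst A b₀ f) := by
  refine measurable_of_restrict_of_restrict_compl (s := (A : Set 𝒳)) A.measurableSet ?_ ?_
  · have : Countable (A : Set 𝒳) := A.countable_toSet.to_subtype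
    exact measurable_of_countable _
  · have : (A : Set 𝒳)ᶜ.domRestrict (extendConst A b₀ f) = fun _ => b₀ := by
      ext x
      exact dif_neg x.2
    rw [this]
    exact measurable_const

/-- On finite sets, `Z` may be replaced by the random function `g (·, Z) : A → B`, and this random
function by one with few values. -/
theorem exists_finite_representation [StandardBorelSpace 𝒳] [StandardBorelSpace 𝒴]
    (J : Measure (𝒳 × 𝒴)) [IsProbabilityMeasure J] (μ : Measure 𝒵) [IsProbabilityMeasure μ]
    {g : 𝒳 × 𝒵 → 𝒴} (hg : Measurable g) (hlaw : (J.fst.prod μ).map (fun p => (p.1, g p)) = J)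
    (hfin : ∫⁻ z, shannonEntropy (fiberKernel J.fst g z) ∂μ ≠ ∞) (A : Finset 𝒳) (B : Finset 𝒴)
    (hA : ∀ᵐ p ∂J, p.1 ∈ A) (hB : ∀ᵐ p ∂J, p.2 ∈ B) :
    ∃ (n : ℕ) (_ : NeZero n) (ν : Measure (Fin n)) (g' : 𝒳 × Fin n → 𝒴),
      n ≤ A.card * (B.card - 1) + 2 ∧ IsProbabilityMeasure ν ∧ Measurable g' ∧
      (J.fst.prod ν).map (fun p => (p.1, g' p)) = J ∧
      ∫⁻ j, shannonEntropy (fiberKernel J.fst g' j) ∂ν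
        ≤ ∫⁻ z, shannonEntropy (fiberKernel J.fst g z) ∂μ := by
  classical
  obtain ⟨p₀, hp₀⟩ := hB.exists
  set b₀ : B := ⟨p₀.2, hp₀⟩
  set σ := J.fst with hσ
  -- the values outside `B` only occur on a null set
  set F : 𝒵 → A → B := fun z a =>
    ⟨if g (a, z) ∈ B then g (a, z) else b₀, by split_ifs with h; exacts [h, b₀.2]⟩ with hF
  have hFm : Measurable F := by
    refine measurable_pi_iff.2 fun a => Measurable.subtype_mk ?_
    have hga : Measurable fun z => g (a, z) := by fun_prop
    exact Measurable.ite (hga B.measurableSet) hga measurable_const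
  have hae : ∀ᵐ q ∂(σ.prod μ), q.1 ∈ A ∧ g q = extendConst A (b₀ : 𝒴) (F q.2) q.1 := by
    have h := hA.and hB
    rw [← hlaw] at h
    filter_upwards [ae_of_ae_map (by fun_prop) h] with q hq
    refine ⟨hq.1, ?_⟩
    have hq2 : g (q.1, q.2) ∈ B := hq.2
    simp [extendConst, hq.1, hF, hq2]
  have hae' : ∀ᵐ z ∂μ, ∀ᵐ x ∂σ, g (x, z) = extendConst A (b₀ : 𝒴) (F z) x := by
    have h := Measure.ae_ae_of_ae_prod
      ((Measure.measurePreserving_swap (μ := μ) (ν := σ)).quasiMeasurePreserving.ae hae)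
    filter_upwards [h] with z hz
    filter_upwards [hz] with x hx using hx.2
  have hAσ : ∀ᵐ x ∂σ, x ∈ A :=
    (ae_map_iff (p := (· ∈ A)) measurable_fst.aemeasurable A.measurableSet).2 hA
  set p := μ.map F with hp
  have : IsProbabilityMeasure p := Measure.isProbabilityMeasure_map hFm.aemeasurable
  set H : (A → B) → ℝ≥0∞ := fun f => shannonEntropy (σ.map (extendConst A (b₀ : 𝒴) f)) with hH
  have hHint : ∫⁻ f, H f ∂p = ∫⁻ z, shannonEntropy (fiberKernel σ g z) ∂μ := by
    rw [hp, lintegral_map (measurable_of_countable _) hFm]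
    refine lintegral_congr_ae ?_
    filter_upwards [hae'] with z hz
    rw [fiberKernel_apply σ hg, Measure.map_congr hz]
  have : Nonempty B := ⟨b₀⟩
  obtain ⟨n, hn, ν, φ, hcard, hν, hmarg, hle⟩ := exists_finite_support p H (by rwa [hHint])
  rw [Fintype.card_coe, Fintype.card_coe] at hcard
  set g' : 𝒳 × Fin n → 𝒴 := fun q => extendConst A (b₀ : 𝒴) (φ q.2) q.1 with hg'
  have hg'm : Measurable g' :=
    measurable_from_prod_countable_left fun j => measurable_extendConst A (b₀ : 𝒴) (φ j)
  refine ⟨n, hn, ν, g', hcard, hν, hg'm, ?_, ?_⟩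
  · conv_rhs => rw [← hlaw]
    ext s hs
    have hm' : Measurable fun q : 𝒳 × Fin n => (q.1, g' q) := by fun_prop
    have hm : Measurable fun q : 𝒳 × 𝒵 => (q.1, g q) := by fun_prop
    rw [Measure.map_apply hm' hs, Measure.map_apply hm hs, Measure.prod_apply (hm' hs),
      Measure.prod_apply (hm hs)]
    refine lintegral_congr_ae ?_
    filter_upwards [hAσ, Measure.ae_ae_of_ae_prod hae] with x hx hxz
    set a : A := ⟨x, hx⟩ with ha
    -- both sides are the mass of `{b | (x, b) ∈ s}` under the law of the value at `a`
    have hlawa : (ν.map fun j => φ j a) = p.map fun f => f a := by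
      refine Measure.ext_of_singleton fun b => ?_
      rw [Measure.map_apply (measurable_of_countable _) (measurableSet_singleton b),
        Measure.map_apply (measurable_of_countable _) (measurableSet_singleton b)]
      exact hmarg a b
    have hsB : MeasurableSet {b : B | (x, (b : 𝒴)) ∈ s} := (Set.toFinite _).measurableSet
    have h1 : ν (Prod.mk x ⁻¹' ((fun q : 𝒳 × Fin n => (q.1, g' q)) ⁻¹' s))
        = (ν.map fun j => φ j a) {b : B | (x, (b : 𝒴)) ∈ s} := by
      rw [Measure.map_apply (measurable_of_countable _) hsB]
      congr 1
      ext j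
      simp [hg', extendConst, hx, ha]
    have h2 : μ (Prod.mk x ⁻¹' ((fun q : 𝒳 × 𝒵 => (q.1, g q)) ⁻¹' s))
        = (p.map fun f => f a) {b : B | (x, (b : 𝒴)) ∈ s} := by
      rw [hp, Measure.map_map (measurable_of_countable _) hFm, Measure.map_apply
        ((measurable_of_countable _).comp hFm) hsB]
      refine measure_congr ?_
      filter_upwards [hxz] with z hz
      have : ((x, g (x, z)) ∈ s) = ((x, ((F z a : B) : 𝒴)) ∈ s) := by
        rw [hz.2]; simp [extendConst, hx, ha]
      exact this
    rw [h1, h2, hlawa]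
  · rw [← hHint]
    refine le_trans (le_of_eq ?_) hle
    refine lintegral_congr fun j => ?_
    rw [fiberKernel_apply _ hg'm]

end FiniteRepresentation

/-! ### The strong functional representation lemma -/

section Main

/-- A functional representation of small entropy yields the required auxiliary variable. -/
theorem exists_auxiliary {Ω : Type*} {𝒳 : Type*} {𝒴 : Type*} {𝒵 : Type*} [MeasurableSpace Ω]
    [MeasurableSpace 𝒳] [StandardBorelSpace 𝒳] [Nonempty 𝒳] [MeasurableSpace 𝒴]
    [StandardBorelSpace 𝒴] [Nonempty 𝒴] [MeasurableSpace 𝒵] [StandardBorelSpace 𝒵] [Nonempty 𝒵]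
    (P : Measure Ω) [IsProbabilityMeasure P] {X : Ω → 𝒳} {Y : Ω → 𝒴} (hX : Measurable X)
    (hY : Measurable Y) (hI : mutualInfo X Y P < ∞) (μ : Measure 𝒵) [IsProbabilityMeasure μ]
    {g : 𝒳 × 𝒵 → 𝒴} (hg : Measurable g)
    (hlaw : ((P.map X).prod μ).map (fun p => (p.1, g p)) = P.map fun ω => (X ω, Y ω)) {c : ℝ≥0∞}
    (hH : ∫⁻ z, shannonEntropy (fiberKernel (P.map X) g z) ∂μ ≤ mutualInfo X Y P + c) :
    ∃ (Q : Measure (Ω × 𝒵)) (_ : IsProbabilityMeasure Q),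
      Q.map Prod.fst = P ∧
      IndepFun (fun p : Ω × 𝒵 => X p.1) (fun p : Ω × 𝒵 => p.2) Q ∧
      (∀ᵐ p ∂Q, Y p.1 = g (X p.1, p.2)) ∧
      condMutualInfo (fun p : Ω × 𝒵 => X p.1) (fun p : Ω × 𝒵 => p.2)
        (fun p : Ω × 𝒵 => Y p.1) Q ≤ c ∧
      condEntropy (fun p : Ω × 𝒵 => Y p.1) (fun p : Ω × 𝒵 => p.2) Q ≤ mutualInfo X Y P + c := by
  have : IsProbabilityMeasure (P.map X) := Measure.isProbabilityMeasure_map hX.aemeasurable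
  obtain ⟨Q, hQ, hfst, hQlaw⟩ := exists_enlargement P hX hY μ hg hlaw
  have hX' : Measurable fun p : Ω × 𝒵 => X p.1 := by fun_prop
  have hY' : Measurable fun p : Ω × 𝒵 => Y p.1 := by fun_prop
  have hZ' : Measurable fun p : Ω × 𝒵 => p.2 := measurable_snd
  have hE : condEntropy (fun p : Ω × 𝒵 => Y p.1) (fun p : Ω × 𝒵 => p.2) Q
      ≤ mutualInfo X Y P + c :=
    (condEntropy_eq_of_map_eq hX' hY' hZ' hg hQlaw).le.trans hH
  have hMI : mutualInfo (fun p : Ω × 𝒵 => X p.1) (fun p : Ω × 𝒵 => Y p.1) Q = mutualInfo X Y P := by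
    have e1 : Q.map (fun p => X p.1) = P.map X := by
      rw [← hfst, Measure.map_map hX measurable_fst]; rfl
    have e2 : Q.map (fun p => Y p.1) = P.map Y := by
      rw [← hfst, Measure.map_map hY measurable_fst]; rfl
    have e3 : Q.map (fun p => (X p.1, Y p.1)) = P.map fun ω => (X ω, Y ω) := by
      rw [← hfst, Measure.map_map (by fun_prop) measurable_fst]; rfl
    rw [mutualInfo, e1, e2, e3, mutualInfo]
  refine ⟨Q, hQ, hfst, indepFun_of_map_eq hX' hY' hZ' hg hQlaw,
    ae_eq_of_map_eq hX' hY' hZ' hg hQlaw, ?_, hE⟩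
  have h := (condMutualInfo_add_mutualInfo_le hX' hY' hZ' hg hQlaw).trans hE
  rw [hMI, add_comm] at h
  exact (ENNReal.add_le_add_iff_left hI.ne).1 h

end Main

end

/-- The auxiliary variable `Z` lives on an enlargement `(Ω × 𝒵, Q)` of the given probability space:
the first marginal of `Q` is `P`, the variables `X`, `Y` are read off the first coordinate, and `Z`
is the second coordinate. -/
theorem theorem1 {Ω : Type w} [MeasurableSpace Ω] (P : Measure Ω) [IsProbabilityMeasure P]
    {𝒳 : Type u} [TopologicalSpace 𝒳] [PolishSpace 𝒳] [MeasurableSpace 𝒳] [BorelSpace 𝒳]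
    [Nonempty 𝒳]
    {𝒴 : Type v} [TopologicalSpace 𝒴] [PolishSpace 𝒴] [MeasurableSpace 𝒴] [BorelSpace 𝒴]
    [Nonempty 𝒴]
    (X : Ω → 𝒳) (Y : Ω → 𝒴) (hX : Measurable X) (hY : Measurable Y)
    (hI : mutualInfo X Y P < ∞) :
    (∃ (𝒵 : Type v) (_ : MeasurableSpace 𝒵) (_ : StandardBorelSpace 𝒵) (_ : Nonempty 𝒵)
      (Q : Measure (Ω × 𝒵)) (_ : IsProbabilityMeasure Q) (g : 𝒳 × 𝒵 → 𝒴),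
        Q.map Prod.fst = P ∧
        Measurable g ∧
        IndepFun (fun p : Ω × 𝒵 => X p.1) (fun p : Ω × 𝒵 => p.2) Q ∧
        (∀ᵐ p ∂Q, Y p.1 = g (X p.1, p.2)) ∧
        condMutualInfo (fun p : Ω × 𝒵 => X p.1) (fun p : Ω × 𝒵 => p.2)
            (fun p : Ω × 𝒵 => Y p.1) Q
          ≤ ENNReal.ofReal (Real.logb 2 ((mutualInfo X Y P).toReal + 1) + 4) ∧
        condEntropy (fun p : Ω × 𝒵 => Y p.1) (fun p : Ω × 𝒵 => p.2) Q
          ≤ mutualInfo X Y P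
            + ENNReal.ofReal (Real.logb 2 ((mutualInfo X Y P).toReal + 1) + 4)) ∧
    (∀ (A : Finset 𝒳) (B : Finset 𝒴), (∀ᵐ ω ∂P, X ω ∈ A) → (∀ᵐ ω ∂P, Y ω ∈ B) →
      ∃ (n : ℕ) (_ : NeZero n) (Q : Measure (Ω × Fin n)) (_ : IsProbabilityMeasure Q)
        (g : 𝒳 × Fin n → 𝒴),
        n ≤ A.card * (B.card - 1) + 2 ∧
        Q.map Prod.fst = P ∧
        Measurable g ∧
        IndepFun (fun p : Ω × Fin n => X p.1) (fun p : Ω × Fin n => p.2) Q ∧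
        (∀ᵐ p ∂Q, Y p.1 = g (X p.1, p.2)) ∧
        condMutualInfo (fun p : Ω × Fin n => X p.1) (fun p : Ω × Fin n => p.2)
            (fun p : Ω × Fin n => Y p.1) Q
          ≤ ENNReal.ofReal (Real.logb 2 ((mutualInfo X Y P).toReal + 1) + 4) ∧
        condEntropy (fun p : Ω × Fin n => Y p.1) (fun p : Ω × Fin n => p.2) Q
          ≤ mutualInfo X Y P
            + ENNReal.ofReal (Real.logb 2 ((mutualInfo X Y P).toReal + 1) + 4)) := by

  have hlog : 0 < Real.log 2 := Real.log_pos one_lt_two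
  set J := P.map fun ω => (X ω, Y ω) with hJ
  have hJP : IsProbabilityMeasure J := Measure.isProbabilityMeasure_map (by fun_prop)
  have hfst : J.fst = P.map X := Measure.fst_map_prodMk hY
  have hsnd : J.snd = P.map Y := Measure.snd_map_prodMk hX
  have hMI : mutualInfo X Y P = klDiv J (J.fst.prod J.snd) / ENNReal.ofReal (Real.log 2) := by
    rw [mutualInfo, hfst, hsnd]
  have hkl : klDiv J (J.fst.prod J.snd) ≠ ∞ := by
    intro h
    rw [hMI, h, ENNReal.top_div_of_ne_top ENNReal.ofReal_ne_top] at hI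
    exact lt_irrefl _ hI
  have hMIr : (mutualInfo X Y P).toReal = (klDiv J (J.fst.prod J.snd)).toReal / Real.log 2 := by
    rw [hMI, ENNReal.toReal_div, ENNReal.toReal_ofReal hlog.le]
  obtain ⟨μ, g, hμ, hg, hlaw, hH⟩ := exists_functional_representation J hkl hMIr
  rw [ENNReal.ofReal_add ENNReal.toReal_nonneg (add_nonneg
    (Real.logb_nonneg one_lt_two (by linarith [ENNReal.toReal_nonneg (a := mutualInfo X Y P)]))
    (by norm_num)), ENNReal.ofReal_toReal hI.ne] at hH
  refine ⟨?_, fun A B hA hB => ?_⟩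
  · rw [hfst] at hlaw hH
    obtain ⟨Q, hQ, h1, h2, h3, h4, h5⟩ := exists_auxiliary P hX hY hI μ hg hlaw hH
    exact ⟨ℕ → 𝒴 × ℝ, inferInstance, inferInstance, inferInstance, Q, hQ, g, h1, hg, h2, h3, h4, h5⟩
  · have hA' : ∀ᵐ p ∂J, p.1 ∈ A :=
      (ae_map_iff (p := fun q : 𝒳 × 𝒴 => q.1 ∈ A) (by fun_prop)
        (measurable_fst A.measurableSet)).2 hA
    have hB' : ∀ᵐ p ∂J, p.2 ∈ B :=
      (ae_map_iff (p := fun q : 𝒳 × 𝒴 => q.2 ∈ B) (by fun_prop)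
        (measurable_snd B.measurableSet)).2 hB
    obtain ⟨n, hn, ν, g', hcard, hν, hg', hlaw', hle⟩ := exists_finite_representation J μ hg hlaw
      (hH.trans_lt (ENNReal.add_lt_top.2 ⟨hI, ENNReal.ofReal_lt_top⟩)).ne A B hA' hB'
    replace hle := hle.trans hH
    rw [hfst] at hlaw' hle
    obtain ⟨Q, hQ, h1, h2, h3, h4, h5⟩ := exists_auxiliary P hX hY hI ν hg' hlaw' hle
    exact ⟨n, hn, Q, hQ, g', hcard, h1, hg', h2, h3, h4, h5⟩
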